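/- Let $2\le k\le n$ and let $\Omega\subset\mathbb R^n$ be a bounded $C^3$ strictly convex domain (a nonempty bounded open convex set with $C^3$ boundary, all of whose principal curvatures are positive), with outer unit normal $\nu$ on $\partial\Omega$. For a real symmetric matrix $S$ let $\sigma_m(S)$ be the $m$-th elementary symmetric function of its eigenvalues ($\sigma_0=1$); a $C^2$ function $u$ is called $k$-admissible if $\sigma_i(D^2u(x))>0$ for all $x\in\Omega$ and $1\le i\le k$. For every $a>0$ and $A,B\ge 0$ there are constants $\varepsilon_0>0$, $M_1$ and $\overline{M_0}$, depending only on $n$, $k$, $\Omega$, $a$, $A$ and $B$, with the following property. Let $\alpha_0,\dots,\alpha_{k-1}\in C^1(\overline\Omega)$ with $\inf_{\Omega}\alpha_l\ge a$ and $|\alpha_l|_{C^1(\overline\Omega)}\le A$ for all $l$, let $\varphi\in C^2(\partial\Omega)$ with $|\varphi|_{C^2(\partial\Omega)}\le B$ (the norm being the infimum of the $C^2(\overline\Omega)$ norms of the $C^2(\overline\Omega)$ extensions of $\varphi$), let $0<\varepsilon<\varepsilon_0$, and let $u\in C^3(\Omega)\cap C^2(\overline\Omega)$ be a $k$-admissible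 solution of $$\sigma_k(D^2u)=\sum_{l=0}^{k-1}\alpha_l(x)\,\sigma_l(D^2u)\ \text{ in }\Omega,\qquad u_\nu=-\varepsilon u+\varphi(x)\ \text{ on }\partial\Omega .$$ Then $$\sup_\Omega|Du|\le M_1\qquad\text{and}\qquad \sup_\Omega\Big|u-\frac1{|\Omega|}\int_\Omega u\Big|\le\overline{M_0}.$$ In particular the constants do not depend on $\varepsilon$. -/

import Mathlib

open scoped ENNReal NNReal Topology RealInnerProductSpace
open MeasureTheory

noncomputable section

namespace MixedHessian

/-- The Euclidean space `ℝⁿ`. -/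
abbrev E (n : ℕ) := EuclideanSpace ℝ (Fin n)

/-! ### Domains with smooth boundary -/

/-- `ρ` is a `C^m` defining function of `Ω` near the boundary point `p`:
near `p` the set `Ω` is `{ρ < 0}`, and `Dρ(p) ≠ 0`. -/
structure IsLocalDefiningFunction {n : ℕ} (m : ℕ) (Ω : Set (E n)) (p : E n) (ρ : E n → ℝ) :
    Prop where
  contDiffAt : ContDiffAt ℝ (m : WithTop ℕ∞) ρ p
  apply_eq_zero : ρ p = 0
  gradient_ne_zero : gradient ρ p ≠ 0
  mem_iff : ∀ᶠ x in 𝓝 p, (x ∈ Ω ↔ ρ x < 0)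

/-- A bounded `C^m` strictly convex domain (to be used with `m ≥ 2`): a nonempty bounded open
convex set whose boundary is locally the regular zero set of a `C^m` defining function `ρ`, all
principal curvatures of the boundary being positive.  The second fundamental form at `p` with
respect to the inner normal is `D²ρ(p) / |Dρ(p)|` restricted to the tangent space
`{τ : Dρ(p) τ = 0}`. -/
structure IsStrictlyConvexDomain {n : ℕ} (m : ℕ) (Ω : Set (E n)) : Prop where
  isOpen : IsOpen Ω
  nonempty : Ω.Nonempty
  isBounded : Bornology.IsBounded Ω
  convex : Convex ℝ Ω
  boundary : ∀ p ∈ frontier Ω, ∃ ρ : E n → ℝ, IsLocalDefiningFunction m Ω p ρ ∧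
    ∀ τ : E n, τ ≠ 0 → fderiv ℝ ρ p τ = 0 → 0 < fderiv ℝ (fderiv ℝ ρ) p τ τ

/-- `ν` is the outer unit normal of `∂Ω` at `p`, that is `ν = Dρ(p) / |Dρ(p)|` for a `C¹` local
defining function `ρ`. -/
def IsOuterUnitNormal {n : ℕ} (Ω : Set (E n)) (p ν : E n) : Prop :=
  ∃ ρ : E n → ℝ, IsLocalDefiningFunction 1 Ω p ρ ∧ ν = ‖gradient ρ p‖⁻¹ • gradient ρ p

/-! ### `C^m` norms -/

/-- The norm `|f|_{C^m(Ω̄)} = ∑_{j ≤ m} sup_Ω |D^j f|`, with values in `[0, ∞]`. -/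
def cNorm {n : ℕ} (m : ℕ) (Ω : Set (E n)) (f : E n → ℝ) : ℝ≥0∞ :=
  ∑ j ∈ Finset.range (m + 1), ⨆ x ∈ Ω, ‖iteratedFDeriv ℝ j f x‖ₑ

/-- `Φ` is a `C^m(Ω̄)` extension of the function `φ` on `∂Ω`. -/
def IsExtension {n : ℕ} (m : ℕ) (Ω : Set (E n)) (φ Φ : E n → ℝ) : Prop :=
  ContDiffOn ℝ (m : WithTop ℕ∞) Φ (closure Ω) ∧ Set.EqOn Φ φ (frontier Ω)

/-- `φ ∈ C^m(∂Ω)`: the restriction of `φ` to `∂Ω` is the boundary value of a `C^m(Ω̄)` function.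
Only the values of `φ` on `∂Ω` matter. -/
def MemCBoundary {n : ℕ} (m : ℕ) (Ω : Set (E n)) (φ : E n → ℝ) : Prop :=
  ∃ Φ : E n → ℝ, IsExtension m Ω φ Φ

/-- The norm `|φ|_{C^m(∂Ω)}`: the infimum of `|Φ|_{C^m(Ω̄)}` over all `C^m(Ω̄)` extensions `Φ`. -/
def cBoundaryNorm {n : ℕ} (m : ℕ) (Ω : Set (E n)) (φ : E n → ℝ) : ℝ≥0∞ :=
  ⨅ (Φ : E n → ℝ) (_ : IsExtension m Ω φ Φ), cNorm m Ω Φ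

/-! ### Mixed Hessian equations -/

/-- The Hessian matrix `D²u(x)`. -/
def hessian {n : ℕ} (u : E n → ℝ) (x : E n) : Matrix (Fin n) (Fin n) ℝ :=
  Matrix.of fun i j =>
    fderiv ℝ (fderiv ℝ u) x (EuclideanSpace.single i 1) (EuclideanSpace.single j 1)

/-- The eigenvalues of a real matrix with multiplicity (all of them when it is symmetric). -/
def eigenvalues {n : ℕ} (A : Matrix (Fin n) (Fin n) ℝ) : Multiset ℝ :=
  A.charpoly.roots

/-- `σ_m(A)`, the `m`-th elementary symmetric function of the eigenvalues; `σ_0 = 1`. -/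
def sigma {n : ℕ} (m : ℕ) (A : Matrix (Fin n) (Fin n) ℝ) : ℝ :=
  (eigenvalues A).esymm m

/-- Gårding's cone `Γ_k`, for unordered tuples of real numbers. -/
def gardingCone (k : ℕ) : Set (Multiset ℝ) :=
  {s | ∀ i : ℕ, 1 ≤ i → i ≤ k → 0 < s.esymm i}

/-- `u` is `k`-admissible in `Ω`. -/
def IsAdmissible {n : ℕ} (k : ℕ) (Ω : Set (E n)) (u : E n → ℝ) : Prop :=
  ∀ x ∈ Ω, eigenvalues (hessian u x) ∈ gardingCone k

/-- `u ∈ C³(Ω) ∩ C²(Ω̄)` is a `k`-admissible solution of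
`σ_k(D²u) = ∑_{l<k} α_l σ_l(D²u)` in `Ω`, `u_ν = -ε u + φ` on `∂Ω`.
At boundary points the differential of `u` is the one relative to `Ω̄`. -/
structure IsApproxSolution {n : ℕ} (k : ℕ) (Ω : Set (E n)) (α : Fin k → E n → ℝ) (φ : E n → ℝ)
    (ε : ℝ) (u : E n → ℝ) : Prop where
  contDiffOn : ContDiffOn ℝ 3 u Ω
  contDiffOn_closure : ContDiffOn ℝ 2 u (closure Ω)
  admissible : IsAdmissible k Ω u
  equation : ∀ x ∈ Ω, sigma k (hessian u x) = ∑ l : Fin k, α l x * sigma (l : ℕ) (hessian u x)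
  neumann : ∀ p ∈ frontier Ω, ∀ ν : E n, IsOuterUnitNormal Ω p ν →
    fderivWithin ℝ u (closure Ω) p ν = -ε * u p + φ p

end MixedHessian

end

/-!
The gradient bound comes from the maximum principle for `|Du - bN|² + K|x|²/2`, where `N` extends
the outer unit normal and `b` the boundary datum `φ - εu` to `Ω̄`.

The linearized operator, normalized to trace one, is bounded on `u` and on the derivatives of `u`:
this amounts to bounding `σ_0, …, σ_k` by the trace, and Newton's inequalities together with the
equation reduce it to `σ_{k-1}`, which is itself bounded by the trace. Hence there is no interior
maximum once `K` is of order `(1 + M)(1 + εM)`, where `M = sup |Du|`.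

On `∂Ω` the field `Du - bN` is the tangential part of `Du`. At a boundary maximum its normal
derivative is, after exchanging the two derivatives, the tangential derivative of the Neumann
condition plus a curvature term, so that strict convexity bounds it. The result is a quadratic
inequality for `M` whose only terms of degree two carry a factor `ε`; they are absorbed for small
`ε`. The bound of `b` which this needs comes from the Neumann condition at the maximum points of `u`
and of `β|x|²/2 - u`: for `β` large these lie on `∂Ω`, since the equation bounds the least
eigenvalue of `D²u` from above.
-/

noncomputable section

namespace MixedHessian

/-! ### Newton's inequalities -/

section Multiset

theorem esymm_zero (s : Multiset ℝ) : s.esymm 0 = 1 := by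
  simp [Multiset.esymm]

theorem esymm_cons (a : ℝ) (s : Multiset ℝ) (m : ℕ) :
    (a ::ₘ s).esymm (m + 1) = s.esymm (m + 1) + a * s.esymm m := by
  simp only [Multiset.esymm, Multiset.powersetCard_cons, Multiset.map_add, Multiset.sum_add,
    Multiset.map_map, Function.comp_def, Multiset.prod_cons, Multiset.sum_map_mul_left]

theorem esymm_eq_zero_of_card_lt {s : Multiset ℝ} {m : ℕ} (h : Multiset.card s < m) :
    s.esymm m = 0 := by
  simp [Multiset.esymm, Multiset.powersetCard_eq_empty _ h]

theorem newton_inequality_of_card_eq (m : ℕ) (s : Multiset ℝ) (hs : Multiset.card s = m + 2) :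
    2 * (m + 2) * (s.esymm m * s.esymm (m + 2)) ≤ (m + 1) * s.esymm (m + 1) ^ 2 := by
  induction m generalizing s with
  | zero =>
    obtain ⟨x, y, rfl⟩ := Multiset.card_eq_two.1 hs
    have h0 (a : ℝ) (m : ℕ) : Multiset.esymm {a} (m + 2) = 0 :=
      esymm_eq_zero_of_card_lt (by simp)
    have h1 (a : ℝ) : Multiset.esymm {a} 1 = a := by
      rw [← Multiset.cons_zero a, esymm_cons, esymm_eq_zero_of_card_lt (by simp), esymm_zero]
      ring
    simp only [Multiset.insert_eq_cons, zero_add, esymm_cons x {y} 0, esymm_cons x {y} 1, h0, h1,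
      esymm_zero]
    push_cast
    nlinarith [sq_nonneg (x - y)]
  | succ m ih =>
    obtain ⟨a, t, rfl, ht⟩ := Multiset.card_eq_succ_iff.1 hs
    have hih := ih t (by omega)
    rw [esymm_cons a t (m + 2), esymm_cons a t (m + 1), esymm_cons a t m,
      esymm_eq_zero_of_card_lt (s := t) (m := m + 2 + 1) (by omega)]
    set p := t.esymm (m + 2)
    set q := t.esymm (m + 1)
    set r := t.esymm m
    push_cast
    -- Up to the factor `m + 2`, the difference of the two sides is the square
    -- `((m + 2) p - a q) ^ 2` plus `(m + 3) a ^ 2` times the inductive hypothesis.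
    have hdiff : 0 ≤ ((m : ℝ) + 2) * (((m : ℝ) + 1 + 1) * (p + a * q) ^ 2
        - 2 * ((m : ℝ) + 1 + 2) * ((q + a * r) * (0 + a * p))) := by
      have hsq : 0 ≤ (((m : ℝ) + 2) * p - a * q) ^ 2 := sq_nonneg _
      have hih' := mul_le_mul_of_nonneg_left hih
        (show 0 ≤ ((m : ℝ) + 3) * a ^ 2 by positivity)
      nlinarith
    linarith [nonneg_of_mul_nonneg_right hdiff (by positivity)]

theorem splits_derivative {p : Polynomial ℝ} (hp : p.Splits) :
    (Polynomial.derivative p).Splits := by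
  rw [Polynomial.splits_iff_card_roots] at hp ⊢
  have hrolle := p.card_roots_le_derivative
  have hdeg : (Polynomial.derivative p).natDegree = p.natDegree - 1 :=
    Polynomial.natDegree_derivative p
  have hcard := Polynomial.card_roots' (Polynomial.derivative p)
  omega

/-- Up to sign, `t` is the multiset of roots of the derivative of the polynomial with roots `s`. -/
theorem exists_esymm_derivative {n : ℕ} {s : Multiset ℝ} (hs : Multiset.card s = n + 1) :
    ∃ t : Multiset ℝ, Multiset.card t = n ∧
      ∀ j ≤ n, (n + 1 : ℝ) * t.esymm j = (n + 1 - j) * s.esymm j := by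
  set p : Polynomial ℝ := (s.map fun r => Polynomial.X + Polynomial.C r).prod with hp
  have hmonic : p.Monic :=
    Polynomial.monic_multiset_prod_of_monic _ _ fun r _ => Polynomial.monic_X_add_C r
  have hdeg : p.natDegree = n + 1 := by
    rw [hp, Polynomial.natDegree_multiset_prod_of_monic _ (by
      simp only [Multiset.mem_map]
      rintro _ ⟨r, _, rfl⟩
      exact Polynomial.monic_X_add_C r)]
    simp [Multiset.map_map, hs, add_comm]
  have hsplits : p.derivative.Splits := by
    refine splits_derivative (Polynomial.Splits.multisetProd ?_)
    simp only [Multiset.mem_map]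
    rintro _ ⟨r, _, rfl⟩
    exact Polynomial.Splits.X_add_C r
  have hdeg' : p.derivative.natDegree = n := by
    rw [Polynomial.natDegree_derivative, hdeg, Nat.add_sub_cancel]
  have hlead : p.derivative.leadingCoeff = n + 1 := by
    rw [Polynomial.leadingCoeff, hdeg', Polynomial.coeff_derivative, ← hdeg,
      Polynomial.coeff_natDegree, hmonic.leadingCoeff, one_mul]
  have hcard := Polynomial.splits_iff_card_roots.1 hsplits
  refine ⟨p.derivative.roots.map fun r => -r, by rw [Multiset.card_map, hcard, hdeg'],
    fun j hj => ?_⟩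
  have hvieta := Polynomial.coeff_eq_esymm_roots_of_card hcard (k := n - j) (by omega)
  rw [hlead, hdeg', Nat.sub_sub_self hj, Polynomial.coeff_derivative, hp,
    Multiset.prod_X_add_C_coeff _ (by omega), hs, show n + 1 - (n - j + 1) = j by omega,
    mul_assoc, ← Multiset.esymm_neg] at hvieta
  rw [← hvieta]
  push_cast [Nat.cast_sub hj]
  ring

/-- Passing to the roots of the derivative lowers the number of variables to `m + 2`. -/
theorem newton_inequality (m d : ℕ) (s : Multiset ℝ) (hs : Multiset.card s = m + 2 + d) :
    (m + 2) * (d + 2) * (s.esymm m * s.esymm (m + 2)) ≤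
      (m + 1) * (d + 1) * s.esymm (m + 1) ^ 2 := by
  induction d generalizing s with
  | zero =>
    push_cast
    linarith [newton_inequality_of_card_eq m s (by omega)]
  | succ d ih =>
    obtain ⟨t, ht, htj⟩ := exists_esymm_derivative (n := m + 2 + d) hs
    have h0 := htj m (by omega)
    have h1 := htj (m + 1) (by omega)
    have h2 := htj (m + 2) (by omega)
    push_cast at h0 h1 h2 ⊢
    set N : ℝ := (m : ℝ) + 2 + d + 1
    have hN := mul_le_mul_of_nonneg_left (ih t ht) (sq_nonneg N)
    have hpos : (0 : ℝ) < (d + 1) * (d + 2) := by positivity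
    refine le_of_mul_le_mul_left ?_ hpos
    calc (d + 1 : ℝ) * (d + 2) * ((m + 2) * (d + 1 + 2) * (s.esymm m * s.esymm (m + 2)))
        = (m + 2) * (d + 2) * ((N - m) * s.esymm m * ((N - (m + 2)) * s.esymm (m + 2))) := by ring
      _ = N ^ 2 * ((m + 2) * (d + 2) * (t.esymm m * t.esymm (m + 2))) := by rw [← h0, ← h2]; ring
      _ ≤ N ^ 2 * ((m + 1) * (d + 1) * t.esymm (m + 1) ^ 2) := hN
      _ = (m + 1) * (d + 1) * ((N - (m + 1)) * s.esymm (m + 1)) ^ 2 := by rw [← h1]; ring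
      _ = (d + 1) * (d + 2) * ((m + 1) * (d + 1 + 1) * s.esymm (m + 1) ^ 2) := by ring

theorem esymm_mul_esymm_add_two_le_sq (s : Multiset ℝ) (m : ℕ) :
    s.esymm m * s.esymm (m + 2) ≤ s.esymm (m + 1) ^ 2 := by
  rcases lt_or_ge (Multiset.card s) (m + 2) with h | h
  · rw [esymm_eq_zero_of_card_lt h, mul_zero]
    positivity
  · obtain ⟨d, hd⟩ := Nat.exists_eq_add_of_le h
    have hpos : (0 : ℝ) < (m + 2) * (d + 2) := by positivity
    refine le_of_mul_le_mul_left ((newton_inequality m d s hd).trans ?_) hpos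
    gcongr <;> norm_num

theorem esymm_mul_esymm_succ_le {s : Multiset ℝ} {l j : ℕ} (hlj : l ≤ j)
    (hpos : ∀ i ≤ j, 0 < s.esymm i) :
    s.esymm l * s.esymm (j + 1) ≤ s.esymm (l + 1) * s.esymm j := by
  induction j, hlj using Nat.le_induction with
  | base => exact (mul_comm _ _).le
  | succ j hlj ih =>
    have hih := ih fun i hi => hpos i (by omega)
    have hj := hpos j (by omega)
    have hj' := hpos (j + 1) le_rfl
    have hl := hpos l (by omega)
    refine le_of_mul_le_mul_left ?_ hj
    calc s.esymm j * (s.esymm l * s.esymm (j + 1 + 1))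
        = s.esymm l * (s.esymm j * s.esymm (j + 2)) := by ring
      _ ≤ s.esymm l * s.esymm (j + 1) ^ 2 := by
          gcongr
          exact esymm_mul_esymm_add_two_le_sq s j
      _ = s.esymm (j + 1) * (s.esymm l * s.esymm (j + 1)) := by ring
      _ ≤ s.esymm (j + 1) * (s.esymm (l + 1) * s.esymm j) := by gcongr
      _ = s.esymm j * (s.esymm (l + 1) * s.esymm (j + 1)) := by ring

theorem esymm_pos_of_cons_mem_gardingCone {a : ℝ} {s : Multiset ℝ} {k : ℕ}
    (h : a ::ₘ s ∈ gardingCone (k + 1)) {m : ℕ} (hm : m ≤ k) : 0 < s.esymm m := by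
  induction m with
  | zero => rw [esymm_zero]; exact one_pos
  | succ m ih =>
    have h0 := ih (by omega)
    have h1 := h (m + 1) (by omega) (by omega)
    have h2 := h (m + 2) (by omega) (by omega)
    rw [esymm_cons] at h1 h2
    have hnewton := esymm_mul_esymm_add_two_le_sq s m
    by_contra! hneg
    have ha : 0 < a := by
      by_contra! ha
      nlinarith
    nlinarith [mul_pos h0 h2, mul_nonneg (neg_nonneg.2 hneg) h1.le]

end Multiset

/-! ### The mixed Hessian operator on diagonal matrices -/

section Diagonal

variable {ι : Type*} [Fintype ι]

/-- The elementary symmetric function `σ_m(λ)` of a finite family. -/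
def esym (m : ℕ) (lam : ι → ℝ) : ℝ := (Finset.univ.val.map lam).esymm m

theorem esym_zero (lam : ι → ℝ) : esym 0 lam = 1 := esymm_zero _

/-- The diagonal equation `σ_k(λ) = ∑_{l<k} α_l σ_l(λ)` for `λ ∈ Γ_k`, satisfied by the eigenvalues
of the Hessian of an admissible solution. -/
structure IsDiagonalSolution {k : ℕ} (α : Fin k → ℝ) (lam : ι → ℝ) : Prop where
  esym_pos : ∀ m ≤ k, 0 < esym m lam
  equation : esym k lam = ∑ l : Fin k, α l * esym l lam

namespace IsDiagonalSolution

variable {k : ℕ} {α : Fin k → ℝ} {lam : ι → ℝ} {A : ℝ}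

theorem exists_eq_succ (h : IsDiagonalSolution α lam) : ∃ j, k = j + 1 := by
  refine Nat.exists_eq_succ_of_ne_zero ?_
  rintro rfl
  simpa [esym_zero] using h.equation

theorem le_card (h : IsDiagonalSolution α lam) : k ≤ Fintype.card ι := by
  by_contra! hlt
  refine (h.esym_pos k le_rfl).ne' (esymm_eq_zero_of_card_lt ?_)
  rwa [Multiset.card_map, Finset.card_val, Finset.card_univ]

/-- If `σ_k(λ)` were large compared with `σ_{k-1}(λ)`, then Newton's inequalities would make
`σ_l(λ)` increasing in `l`, contradicting the equation. -/
theorem esym_le (h : IsDiagonalSolution α lam) (hα : ∀ l, 0 ≤ α l) (hαA : ∀ l, α l ≤ A) :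
    esym k lam ≤ (1 + k * A) * esym (k - 1) lam := by
  obtain ⟨j, rfl⟩ := h.exists_eq_succ
  rw [Nat.add_sub_cancel]
  have hA : 0 ≤ A := (hα 0).trans (hαA 0)
  have hj := h.esym_pos j (by omega)
  by_contra! hlt
  have hlt' : esym j lam ≤ esym (j + 1) lam := by
    have : 0 ≤ ((j + 1 : ℕ) : ℝ) * A * esym j lam := by positivity
    linarith
  have hstep : ∀ l < j, esym l lam ≤ esym (l + 1) lam := by
    intro l hl
    have hl' := h.esym_pos (l + 1) (by omega)
    refine le_of_mul_le_mul_right ?_ (h.esym_pos (j + 1) le_rfl)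
    calc esym l lam * esym (j + 1) lam ≤ esym (l + 1) lam * esym j lam :=
          esymm_mul_esymm_succ_le hl.le fun m hm => h.esym_pos m (by omega)
      _ ≤ esym (l + 1) lam * esym (j + 1) lam := by gcongr
  have hmono : ∀ l ≤ j, esym l lam ≤ esym j lam := fun l hl =>
    Nat.decreasingInduction (motive := fun l _ => esym l lam ≤ esym j lam)
      (fun m hm ih => (hstep m hm).trans ih) le_rfl hl
  have hle : esym (j + 1) lam ≤ (j + 1 : ℕ) * A * esym j lam := by
    calc esym (j + 1) lam ≤ ∑ _l : Fin (j + 1), A * esym j lam := by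
          rw [h.equation]
          exact Finset.sum_le_sum fun l _ =>
            mul_le_mul (hαA l) (hmono l (by omega)) (h.esym_pos l (by omega)).le hA
      _ = (j + 1 : ℕ) * A * esym j lam := by
          rw [Finset.sum_const, Finset.card_fin, nsmul_eq_mul, mul_assoc]
  linarith

end IsDiagonalSolution

variable [DecidableEq ι]

/-- `σ_m(λ | i)`, the elementary symmetric function of the family `λ` without its `i`-th entry. -/
def esymErase (m : ℕ) (lam : ι → ℝ) (i : ι) : ℝ := ((Finset.univ.erase i).val.map lam).esymm m

theorem map_univ_eq_cons (lam : ι → ℝ) (i : ι) :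
    Finset.univ.val.map lam = lam i ::ₘ (Finset.univ.erase i).val.map lam := by
  rw [← Multiset.map_cons, ← Finset.cons_val (Finset.notMem_erase i _), Finset.cons_eq_insert,
    Finset.insert_erase (Finset.mem_univ i)]

theorem esymErase_zero (lam : ι → ℝ) (i : ι) : esymErase 0 lam i = 1 := esymm_zero _

theorem esym_succ (m : ℕ) (lam : ι → ℝ) (i : ι) :
    esym (m + 1) lam = esymErase (m + 1) lam i + lam i * esymErase m lam i := by
  rw [esym, map_univ_eq_cons lam i, esymm_cons, esymErase, esymErase]

theorem sum_esymErase (m : ℕ) (lam : ι → ℝ) :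
    ∑ i, esymErase m lam i = (Fintype.card ι - m) * esym m lam := by
  simp only [esymErase, esym, Finset.esymm_map_val, Finset.mul_sum]
  rw [Finset.sum_comm' (t' := Finset.univ.powersetCard m) (s' := fun t => tᶜ)
    fun i t => by simp [Finset.mem_powersetCard, Finset.subset_erase, and_comm]]
  refine Finset.sum_congr rfl fun t ht => ?_
  have hcard : t.card = m := (Finset.mem_powersetCard.1 ht).2
  rw [Finset.sum_const, nsmul_eq_mul, Finset.card_compl, Nat.cast_sub t.card_le_univ, hcard]

/-- The partial derivative `∂σ_m/∂λ_i`. -/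
def esymDeriv (m : ℕ) (lam : ι → ℝ) (i : ι) : ℝ :=
  match m with
  | 0 => 0
  | m + 1 => esymErase m lam i

theorem esym_eq_esymErase_add (m : ℕ) (lam : ι → ℝ) (i : ι) :
    esym m lam = esymErase m lam i + lam i * esymDeriv m lam i := by
  cases m with
  | zero => rw [esym_zero, esymErase_zero, esymDeriv, mul_zero, add_zero]
  | succ m => exact esym_succ m lam i

theorem sum_mul_esymDeriv (m : ℕ) (lam : ι → ℝ) :
    ∑ i, lam i * esymDeriv m lam i = m * esym m lam := by
  have hsum : ∑ _i : ι, esym m lam = ∑ i, esymErase m lam i + ∑ i, lam i * esymDeriv m lam i := by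
    rw [← Finset.sum_add_distrib]
    exact Finset.sum_congr rfl fun i _ => esym_eq_esymErase_add m lam i
  rw [sum_esymErase, Finset.sum_const, Finset.card_univ, nsmul_eq_mul] at hsum
  linarith

theorem sq_esym_le_sum_esym_mul_esymDeriv_sub (j : ℕ) (lam : ι → ℝ) (hj : j < Fintype.card ι) :
    esym j lam ^ 2 ≤ (j + 1) *
      ∑ i, (esym j lam * esymDeriv (j + 1) lam i - esymDeriv j lam i * esym (j + 1) lam) := by
  rw [Finset.sum_sub_distrib, ← Finset.mul_sum, ← Finset.sum_mul]
  cases j with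
  | zero =>
    simp only [esymDeriv, esym_zero, esymErase_zero, Finset.sum_const, Finset.card_univ,
      nsmul_eq_mul]
    have hcard : (1 : ℝ) ≤ Fintype.card ι := by exact_mod_cast hj
    simpa using hcard
  | succ q =>
    obtain ⟨d, hd⟩ := Nat.exists_eq_add_of_le (Nat.succ_le_of_lt hj)
    have hnewton : (q + 2 : ℝ) * (d + 2) * (esym q lam * esym (q + 2) lam) ≤
        (q + 1) * (d + 1) * esym (q + 1) lam ^ 2 :=
      newton_inequality q d _ (by rw [Multiset.card_map, Finset.card_val, Finset.card_univ]; omega)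
    simp only [esymDeriv, sum_esymErase, hd]
    push_cast
    have hd0 : 0 ≤ (d : ℝ) * esym (q + 1) lam ^ 2 := by positivity
    linarith

/-- The partial derivative in `λ_i` of `σ_k - ∑_{l<k} α_l σ_l`. -/
def mixedCoeff {k : ℕ} (α : Fin k → ℝ) (lam : ι → ℝ) (i : ι) : ℝ :=
  esymDeriv k lam i - ∑ l : Fin k, α l * esymDeriv (l : ℕ) lam i

namespace IsDiagonalSolution

variable {k : ℕ} {α : Fin k → ℝ} {lam : ι → ℝ} {a A : ℝ}

theorem esymErase_pos (h : IsDiagonalSolution α lam) (i : ι) {m : ℕ} (hm : m < k) :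
    0 < esymErase m lam i := by
  obtain ⟨j, rfl⟩ := h.exists_eq_succ
  refine esymm_pos_of_cons_mem_gardingCone (a := lam i) ?_ (Nat.lt_succ_iff.1 hm)
  rw [← map_univ_eq_cons]
  exact fun m _ hm => h.esym_pos m hm

theorem esymDeriv_mul_esym_le (h : IsDiagonalSolution α lam) (i : ι) {l : ℕ} (hl : l < k) :
    esymDeriv l lam i * esym k lam ≤ esym l lam * esymDeriv k lam i := by
  have herase : esymDeriv l lam i * esymErase k lam i ≤ esymErase l lam i * esymDeriv k lam i := by
    obtain ⟨j, rfl⟩ := h.exists_eq_succ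
    cases l with
    | zero =>
      rw [esymDeriv, zero_mul, esymErase_zero, one_mul]
      exact (h.esymErase_pos i (Nat.lt_succ_self j)).le
    | succ l =>
      exact esymm_mul_esymm_succ_le (by omega) fun m hm => h.esymErase_pos i (by omega)
  rw [esym_eq_esymErase_add k lam i, esym_eq_esymErase_add l lam i]
  linarith

theorem mixedCoeff_mul_esym (h : IsDiagonalSolution α lam) (i : ι) :
    mixedCoeff α lam i * esym k lam
      = ∑ l : Fin k, α l * (esym l lam * esymDeriv k lam i - esymDeriv l lam i * esym k lam) := by
  calc mixedCoeff α lam i * esym k lam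
      = (∑ l : Fin k, α l * esym l lam) * esymDeriv k lam i
        - (∑ l : Fin k, α l * esymDeriv l lam i) * esym k lam := by
        rw [← h.equation, mixedCoeff]
        ring
    _ = _ := by
        rw [Finset.sum_mul, Finset.sum_mul, ← Finset.sum_sub_distrib]
        exact Finset.sum_congr rfl fun l _ => by ring

theorem mul_le_mixedCoeff_mul_esym (h : IsDiagonalSolution α lam) (hα : ∀ l, 0 ≤ α l) (i : ι)
    (l : Fin k) :
    α l * (esym l lam * esymDeriv k lam i - esymDeriv l lam i * esym k lam)
      ≤ mixedCoeff α lam i * esym k lam := by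
  rw [h.mixedCoeff_mul_esym]
  exact Finset.single_le_sum (f := fun l : Fin k =>
    α l * (esym l lam * esymDeriv k lam i - esymDeriv l lam i * esym k lam))
    (fun l _ => mul_nonneg (hα l) (sub_nonneg.2 (h.esymDeriv_mul_esym_le i l.2)))
    (Finset.mem_univ l)

theorem mixedCoeff_nonneg (h : IsDiagonalSolution α lam) (hα : ∀ l, 0 ≤ α l) (i : ι) :
    0 ≤ mixedCoeff α lam i := by
  obtain ⟨j, rfl⟩ := h.exists_eq_succ
  refine nonneg_of_mul_nonneg_left ?_ (h.esym_pos _ le_rfl)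
  exact (mul_nonneg (hα 0) (sub_nonneg.2 (h.esymDeriv_mul_esym_le i (l := 0) j.succ_pos))).trans
    (h.mul_le_mixedCoeff_mul_esym hα i 0)

theorem mul_sq_esym_le (h : IsDiagonalSolution α lam) (ha : 0 ≤ a) (hα : ∀ l, a ≤ α l) :
    a * esym (k - 1) lam ^ 2 ≤ k * ((∑ i, mixedCoeff α lam i) * esym k lam) := by
  have hcard := h.le_card
  obtain ⟨j, rfl⟩ := h.exists_eq_succ
  have hterm (i : ι) : a * (esym j lam * esymDeriv (j + 1) lam i
      - esymDeriv j lam i * esym (j + 1) lam) ≤ mixedCoeff α lam i * esym (j + 1) lam := by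
    refine le_trans ?_
      (h.mul_le_mixedCoeff_mul_esym (fun l => ha.trans (hα l)) i (Fin.last j))
    exact mul_le_mul_of_nonneg_right (hα _)
      (sub_nonneg.2 (h.esymDeriv_mul_esym_le i j.lt_succ_self))
  have hsum := Finset.sum_le_sum fun i (_ : i ∈ Finset.univ) => hterm i
  rw [← Finset.mul_sum, ← Finset.sum_mul] at hsum
  have hnewton := sq_esym_le_sum_esym_mul_esymDeriv_sub j lam hcard
  push_cast
  nlinarith

theorem sum_esym_le (h : IsDiagonalSolution α lam) (ha : 0 < a) (hαa : ∀ l, a ≤ α l)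
    (hαA : ∀ l, α l ≤ A) :
    ∑ l : Fin k, esym l lam ≤ (k * (1 + k * A) / a) ^ 2 * ∑ i, mixedCoeff α lam i := by
  have hα : ∀ l, 0 ≤ α l := fun l => ha.le.trans (hαa l)
  have hA : 0 ≤ A := by
    obtain ⟨j, rfl⟩ := h.exists_eq_succ
    exact (hα 0).trans (hαA 0)
  set R : ℝ := 1 + k * A
  set T := ∑ i, mixedCoeff α lam i
  have hT : 0 ≤ T := Finset.sum_nonneg fun i _ => h.mixedCoeff_nonneg hα i
  have hR : 0 < R := by positivity
  have htop : esym k lam ≤ R * esym (k - 1) lam := h.esym_le hα hαA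
  have hpenult : esym (k - 1) lam ≤ k * R / a * T := by
    rw [div_mul_eq_mul_div, le_div_iff₀ ha]
    refine le_of_mul_le_mul_right ?_ (h.esym_pos (k - 1) (Nat.sub_le k 1))
    calc esym (k - 1) lam * a * esym (k - 1) lam = a * esym (k - 1) lam ^ 2 := by ring
      _ ≤ k * (T * esym k lam) := h.mul_sq_esym_le ha.le hαa
      _ ≤ k * (T * (R * esym (k - 1) lam)) := by gcongr
      _ = k * R * T * esym (k - 1) lam := by ring
  have hlow (l : Fin k) : esym l lam ≤ R / a * esym (k - 1) lam := by
    rw [div_mul_eq_mul_div, le_div_iff₀ ha]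
    have hpos (l : Fin k) : 0 ≤ esym l lam := (h.esym_pos l l.2.le).le
    calc esym l lam * a ≤ α l * esym l lam := by
          rw [mul_comm]
          exact mul_le_mul_of_nonneg_right (hαa l) (hpos l)
      _ ≤ esym k lam := by
          rw [h.equation]
          exact Finset.single_le_sum (f := fun l : Fin k => α l * esym l lam)
            (fun l _ => mul_nonneg (hα l) (hpos l)) (Finset.mem_univ l)
      _ ≤ R * esym (k - 1) lam := htop
  calc ∑ l : Fin k, esym l lam ≤ ∑ _l : Fin k, R / a * esym (k - 1) lam :=
        Finset.sum_le_sum fun l _ => hlow l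
    _ = k * R / a * esym (k - 1) lam := by
        rw [Finset.sum_const, Finset.card_fin, nsmul_eq_mul]
        ring
    _ ≤ k * R / a * (k * R / a * T) := by gcongr
    _ = (k * R / a) ^ 2 * T := by ring

theorem sum_mul_mixedCoeff (h : IsDiagonalSolution α lam) :
    ∑ i, lam i * mixedCoeff α lam i = ∑ l : Fin k, (k - (l : ℕ)) * (α l * esym l lam) := by
  calc ∑ i, lam i * mixedCoeff α lam i
      = k * esym k lam - ∑ l : Fin k, α l * ∑ i, lam i * esymDeriv l lam i := by
        simp only [mixedCoeff, mul_sub, Finset.sum_sub_distrib, Finset.mul_sum]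
        rw [sum_mul_esymDeriv, Finset.sum_comm]
        simp only [mul_left_comm]
    _ = ∑ l : Fin k, (k - (l : ℕ)) * (α l * esym l lam) := by
        rw [h.equation, Finset.mul_sum, ← Finset.sum_sub_distrib]
        exact Finset.sum_congr rfl fun l _ => by rw [sum_mul_esymDeriv]; ring

theorem abs_sum_mul_mixedCoeff_le (h : IsDiagonalSolution α lam) (hα : ∀ l, 0 ≤ α l)
    (hαA : ∀ l, α l ≤ A) :
    |∑ i, lam i * mixedCoeff α lam i| ≤ k * A * ∑ l : Fin k, esym l lam := by
  have hesym (l : Fin k) : 0 ≤ esym l lam := (h.esym_pos l l.2.le).le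
  have hkl (l : Fin k) : (0 : ℝ) ≤ k - (l : ℕ) := sub_nonneg.2 (by exact_mod_cast l.2.le)
  rw [h.sum_mul_mixedCoeff, abs_of_nonneg (Finset.sum_nonneg fun l _ =>
    mul_nonneg (hkl l) (mul_nonneg (hα l) (hesym l))), Finset.mul_sum]
  refine Finset.sum_le_sum fun l _ => ?_
  rw [mul_assoc]
  have hA : 0 ≤ A := (hα l).trans (hαA l)
  have hesym_l := hesym l
  have hα_l := hα l
  have hαA_l := hαA l
  gcongr
  linarith [(Nat.cast_nonneg (l : ℕ) : (0 : ℝ) ≤ (l : ℕ))]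

end IsDiagonalSolution

end Diagonal

namespace IsDiagonalSolution

variable {ι : Type*} [Fintype ι] {k : ℕ} {α : Fin k → ℝ} {lam : ι → ℝ} {A : ℝ}

theorem exists_lt (h : IsDiagonalSolution α lam) (hα : ∀ l, 0 ≤ α l) (hαA : ∀ l, α l ≤ A) {β : ℝ}
    (hβ : k * (1 + k * A) < β) : ∃ i, lam i < β := by
  classical
  by_contra! hall
  have htop := h.esym_le hα hαA
  have hcard := h.le_card
  obtain ⟨j, rfl⟩ := h.exists_eq_succ
  have hA : 0 ≤ A := (hα 0).trans (hαA 0)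
  have hβ0 : 0 < β := lt_of_le_of_lt (by positivity) hβ
  have hj := h.esym_pos j (by omega)
  refine lt_irrefl (β * esym j lam) ?_
  calc β * esym j lam ≤ β * ((Fintype.card ι - j) * esym j lam) := by
        have : (1 : ℝ) ≤ Fintype.card ι - j := by
          have : ((j + 1 : ℕ) : ℝ) ≤ Fintype.card ι := by exact_mod_cast hcard
          push_cast at this
          linarith
        gcongr
        nlinarith
    _ = ∑ i, β * esymErase j lam i := by rw [← Finset.mul_sum, sum_esymErase]
    _ ≤ ∑ i, lam i * esymDeriv (j + 1) lam i := Finset.sum_le_sum fun i _ =>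
        mul_le_mul_of_nonneg_right (hall i) (h.esymErase_pos i j.lt_succ_self).le
    _ = (j + 1 : ℕ) * esym (j + 1) lam := sum_mul_esymDeriv _ _
    _ ≤ (j + 1 : ℕ) * ((1 + (j + 1 : ℕ) * A) * esym j lam) := by gcongr; exact htop
    _ < β * esym j lam := by
        rw [← mul_assoc]
        exact mul_lt_mul_of_pos_right hβ hj

theorem exists_pos (h : IsDiagonalSolution α lam) : ∃ i, 0 < lam i := by
  classical
  by_contra! hall
  obtain ⟨j, rfl⟩ := h.exists_eq_succ
  refine (h.esym_pos 1 (by omega)).not_ge ?_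
  calc esym 1 lam = ∑ i, lam i * esymDeriv 1 lam i := by simp [sum_mul_esymDeriv]
    _ ≤ 0 := Finset.sum_nonpos fun i _ =>
      mul_nonpos_of_nonpos_of_nonneg (hall i) (h.esymErase_pos i j.succ_pos).le

end IsDiagonalSolution

/-! ### The derivative of the characteristic polynomial at a diagonal matrix -/

section Charpoly

theorem exists_ne_apply_ne {ι : Type*} {σ : Equiv.Perm ι} (hσ : σ ≠ 1) (i : ι) :
    ∃ j ≠ i, σ j ≠ j := by
  by_contra! h
  have hi : σ i = i := by_contra fun hne => hne (σ.injective (h _ hne))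
  exact hσ (Equiv.ext fun j => (eq_or_ne j i).elim (fun hj => hj ▸ hi) (h j))

variable {ι : Type*} [Fintype ι] [DecidableEq ι] {M : ℝ → Matrix ι ι ℝ} {B : Matrix ι ι ℝ}
  {d : ι → ℝ} {t₀ : ℝ}

theorem hasDerivAt_det_of_eq_diagonal (hM : ∀ i j, HasDerivAt (fun t => M t i j) (B i j) t₀)
    (h₀ : M t₀ = Matrix.diagonal d) :
    HasDerivAt (fun t => (M t).det) (∑ i, B i i * ∏ j ∈ Finset.univ.erase i, d j) t₀ := by
  have hdet : HasDerivAt (fun t => (M t).det)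
      (∑ σ : Equiv.Perm ι, ((Equiv.Perm.sign σ : ℤ) : ℝ) *
        ∑ i, (∏ j ∈ Finset.univ.erase i, M t₀ (σ j) j) • B (σ i) i) t₀ := by
    simp only [Matrix.det_apply']
    exact HasDerivAt.fun_sum fun σ _ =>
      (HasDerivAt.fun_finsetProd fun i _ => hM (σ i) i).const_mul _
  refine hdet.congr_deriv ?_
  rw [Finset.sum_eq_single_of_mem (1 : Equiv.Perm ι) (Finset.mem_univ _)]
  · simp [h₀, mul_comm]
  · intro σ _ hσ
    rw [Finset.sum_eq_zero, mul_zero]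
    intro i _
    obtain ⟨j, hji, hj⟩ := exists_ne_apply_ne hσ i
    rw [Finset.prod_eq_zero (Finset.mem_erase.2 ⟨hji, Finset.mem_univ j⟩), zero_smul]
    rw [h₀, Matrix.diagonal_apply_ne _ hj]

theorem hasDerivAt_eval_charpoly (hM : ∀ i j, HasDerivAt (fun t => M t i j) (B i j) t₀)
    (h₀ : M t₀ = Matrix.diagonal d) (z : ℝ) :
    HasDerivAt (fun t => (M t).charpoly.eval z)
      (-∑ i, B i i * ∏ j ∈ Finset.univ.erase i, (z - d j)) t₀ := by
  simp only [Matrix.eval_charpoly]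
  have hdiag : Matrix.scalar ι z - M t₀ = Matrix.diagonal fun i => z - d i := by
    rw [h₀, Matrix.scalar_apply, Matrix.diagonal_sub]
  have hentry : ∀ i j, HasDerivAt (fun t => (Matrix.scalar ι z - M t) i j) ((-B) i j) t₀ :=
    fun i j => (hM i j).const_sub (Matrix.scalar ι z i j)
  simpa [Finset.sum_neg_distrib] using hasDerivAt_det_of_eq_diagonal hentry hdiag

theorem exists_coeff_eq_sum_eval (n m : ℕ) : ∃ v w : Fin (n + 1) → ℝ,
    ∀ p : Polynomial ℝ, p.natDegree ≤ n → p.coeff m = ∑ i, w i * p.eval (v i) := by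
  let v : Fin (n + 1) → ℝ := fun i => (i : ℕ)
  have hv : Set.InjOn v (Finset.univ : Finset (Fin (n + 1))) :=
    fun i _ j _ hij => Fin.ext (Nat.cast_injective hij)
  refine ⟨v, fun i => (Lagrange.basis Finset.univ v i).coeff m, fun p hp => ?_⟩
  have hdeg : p.degree < (Finset.univ : Finset (Fin (n + 1))).card := by
    rw [Finset.card_fin]
    exact p.degree_le_natDegree.trans_lt (by exact_mod_cast Nat.lt_succ_of_le hp)
  conv_lhs => rw [Lagrange.eq_interpolate hv hdeg]
  simp only [Lagrange.interpolate_apply, Polynomial.finsetSum_coeff, Polynomial.coeff_C_mul,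
    mul_comm]

theorem hasDerivAt_charpoly_coeff (hM : ∀ i j, HasDerivAt (fun t => M t i j) (B i j) t₀)
    (h₀ : M t₀ = Matrix.diagonal d) (m : ℕ) :
    HasDerivAt (fun t => (M t).charpoly.coeff m)
      (-∑ i, B i i *
        (∏ j ∈ Finset.univ.erase i, (Polynomial.X - Polynomial.C (d j))).coeff m) t₀ := by
  obtain ⟨v, w, hvw⟩ := exists_coeff_eq_sum_eval (Fintype.card ι) m
  have hcoeff : ∀ t, (M t).charpoly.coeff m = ∑ s, w s * (M t).charpoly.eval (v s) :=
    fun t => hvw _ (M t).charpoly_natDegree_eq_dim.le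
  have hprod : ∀ i, (∏ j ∈ Finset.univ.erase i, (Polynomial.X - Polynomial.C (d j))).coeff m
      = ∑ s, w s * ∏ j ∈ Finset.univ.erase i, (v s - d j) := by
    intro i
    rw [hvw _ ((Polynomial.natDegree_finsetProd_X_sub_C_eq_card _ _).trans_le
      (Finset.card_le_univ _))]
    simp only [Polynomial.eval_prod, Polynomial.eval_sub, Polynomial.eval_X, Polynomial.eval_C]
  simp only [hcoeff, hprod]
  refine (HasDerivAt.fun_sum fun s _ =>
    (hasDerivAt_eval_charpoly hM h₀ (v s)).const_mul (w s)).congr_deriv ?_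
  simp only [mul_neg, Finset.sum_neg_distrib, Finset.mul_sum]
  rw [Finset.sum_comm]
  simp only [mul_left_comm]

theorem coeff_prod_erase_X_sub_C (lam : ι → ℝ) (i : ι) {m : ℕ} (hm : m < Fintype.card ι) :
    (∏ j ∈ Finset.univ.erase i, (Polynomial.X - Polynomial.C (lam j))).coeff
      (Fintype.card ι - (m + 1)) = (-1) ^ m * esymErase m lam i := by
  have hcard : Multiset.card ((Finset.univ.erase i).val.map lam) = Fintype.card ι - 1 := by
    rw [Multiset.card_map, Finset.card_val, Finset.card_erase_of_mem (Finset.mem_univ i),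
      Finset.card_univ]
  have hcoeff := Multiset.prod_X_sub_C_coeff ((Finset.univ.erase i).val.map lam)
    (k := Fintype.card ι - (m + 1)) (by omega)
  rwa [hcard, show Fintype.card ι - 1 - (Fintype.card ι - (m + 1)) = m by omega,
    Multiset.map_map] at hcoeff

end Charpoly

/-! ### The Hessian in an orthonormal eigenbasis -/

section Riesz

variable {V : Type*} [NormedAddCommGroup V] [InnerProductSpace ℝ V] [CompleteSpace V]

/-- The Riesz representation of a continuous linear form, as a linear operator. -/
def riesz : StrongDual ℝ V →L[ℝ] V :=
  ((InnerProductSpace.toDual ℝ V).symm.toContinuousLinearEquiv : StrongDual ℝ V →L⋆[ℝ] V)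

theorem inner_riesz (f : StrongDual ℝ V) (v : V) : ⟪riesz f, v⟫ = f v :=
  InnerProductSpace.toDual_symm_apply

end Riesz

section Hessian

variable {n : ℕ} {u : E n → ℝ} {x : E n} {H : E n →L[ℝ] E n →L[ℝ] ℝ}
  {e : OrthonormalBasis (Fin n) ℝ (E n)} {lam : Fin n → ℝ}

/-- The matrix of a bilinear form in an orthonormal basis. -/
def formMatrix (H : E n →L[ℝ] E n →L[ℝ] ℝ) (e : OrthonormalBasis (Fin n) ℝ (E n)) :
    Matrix (Fin n) (Fin n) ℝ :=
  Matrix.of fun i j => H (e i) (e j)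

theorem charpoly_formMatrix (H : E n →L[ℝ] E n →L[ℝ] ℝ) (e : OrthonormalBasis (Fin n) ℝ (E n)) :
    (formMatrix H e).charpoly = (riesz ∘L H).toLinearMap.charpoly := by
  rw [← LinearMap.charpoly_toMatrix _ e.toBasis, ← Matrix.charpoly_transpose]
  congr 1
  ext i j
  rw [Matrix.transpose_apply, LinearMap.toMatrix_apply, OrthonormalBasis.coe_toBasis_repr_apply,
    OrthonormalBasis.repr_apply_apply, OrthonormalBasis.coe_toBasis, real_inner_comm]
  exact (inner_riesz (H (e j)) (e i)).symm

theorem charpoly_hessian (u : E n → ℝ) (x : E n) (e : OrthonormalBasis (Fin n) ℝ (E n)) :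
    (hessian u x).charpoly = (formMatrix (fderiv ℝ (fderiv ℝ u) x) e).charpoly := by
  rw [charpoly_formMatrix, ← charpoly_formMatrix _ (EuclideanSpace.basisFun (Fin n) ℝ)]
  simp only [formMatrix, EuclideanSpace.basisFun_apply]
  rfl

theorem exists_formMatrix_eq_diagonal (hH : ∀ v w, H v w = H w v) :
    ∃ (e : OrthonormalBasis (Fin n) ℝ (E n)) (lam : Fin n → ℝ),
      formMatrix H e = Matrix.diagonal lam := by
  have hinner : ∀ v w, ⟪riesz (H v), w⟫ = H v w := fun v w => inner_riesz (H v) w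
  have hsymm : (riesz ∘L H).toLinearMap.IsSymmetric := fun v w =>
    (hinner v w).trans <| (hH v w).trans <| (hinner w v).symm.trans (real_inner_comm _ _)
  have hn : Module.finrank ℝ (E n) = n := finrank_euclideanSpace_fin
  refine ⟨hsymm.eigenvectorBasis hn, hsymm.eigenvalues hn, ?_⟩
  ext i j
  rw [formMatrix, Matrix.of_apply, ← hinner]
  change ⟪(riesz ∘L H).toLinearMap _, _⟫ = _
  rw [hsymm.apply_eigenvectorBasis, inner_smul_left,
    orthonormal_iff_ite.1 (hsymm.eigenvectorBasis hn).orthonormal i j, Matrix.diagonal_apply]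
  simp

theorem eigenvalues_hessian (h : formMatrix (fderiv ℝ (fderiv ℝ u) x) e = Matrix.diagonal lam) :
    eigenvalues (hessian u x) = Finset.univ.val.map lam := by
  rw [eigenvalues, charpoly_hessian u x e, h, Matrix.charpoly_diagonal,
    ← Polynomial.roots_multiset_prod_X_sub_C (Finset.univ.val.map lam), Multiset.map_map]
  rfl

theorem sigma_hessian (h : formMatrix (fderiv ℝ (fderiv ℝ u) x) e = Matrix.diagonal lam) (m : ℕ) :
    sigma m (hessian u x) = esym m lam := by
  rw [sigma, eigenvalues_hessian h, esym]

theorem sigma_hessian_eq_coeff (hu : IsSymmSndFDerivAt ℝ u x) {m : ℕ} (hm : m ≤ n) :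
    sigma m (hessian u x) = (-1) ^ m * (hessian u x).charpoly.coeff (n - m) := by
  obtain ⟨e, lam, h⟩ := exists_formMatrix_eq_diagonal hu
  have hdeg : (hessian u x).charpoly.natDegree = n := by
    rw [Matrix.charpoly_natDegree_eq_dim, Fintype.card_fin]
  have hcard : Multiset.card (hessian u x).charpoly.roots
      = (hessian u x).charpoly.natDegree := by
    rw [← eigenvalues, eigenvalues_hessian h, hdeg, Multiset.card_map, Finset.card_val,
      Finset.card_fin]
  rw [Polynomial.coeff_eq_esymm_roots_of_card hcard (by omega), hdeg,
    (Matrix.charpoly_monic _).leadingCoeff, Nat.sub_sub_self hm, one_mul, ← mul_assoc, ← mul_pow,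
    neg_one_mul, neg_neg, one_pow, one_mul, sigma, eigenvalues]

theorem exists_eigenbasis {k : ℕ} {Ω : Set (E n)} {α : Fin k → E n → ℝ} (hx : x ∈ Ω)
    (hu : ContDiffAt ℝ 2 u x) (hadm : IsAdmissible k Ω u)
    (heq : ∀ x ∈ Ω, sigma k (hessian u x) = ∑ l : Fin k, α l x * sigma (l : ℕ) (hessian u x)) :
    ∃ (e : OrthonormalBasis (Fin n) ℝ (E n)) (lam : Fin n → ℝ),
      formMatrix (fderiv ℝ (fderiv ℝ u) x) e = Matrix.diagonal lam ∧
      IsDiagonalSolution (fun l => α l x) lam := by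
  obtain ⟨e, lam, h⟩ := exists_formMatrix_eq_diagonal (hu.isSymmSndFDerivAt (by simp))
  refine ⟨e, lam, h, fun m hm => ?_, ?_⟩
  · rcases Nat.eq_zero_or_pos m with rfl | hm0
    · simp only [esym_zero, zero_lt_one]
    · rw [← sigma_hessian h, sigma]
      exact hadm x hx m hm0 hm
  · simpa only [sigma_hessian h] using heq x hx

end Hessian

/-! ### Second derivatives along lines -/

section Line

variable {V : Type*} [NormedAddCommGroup V] [NormedSpace ℝ V] {F : Type*} [NormedAddCommGroup F]
  [NormedSpace ℝ F] {f : V → F} {x : V} {t : ℝ}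

theorem hasDerivAt_line (x e : V) (t : ℝ) : HasDerivAt (fun s : ℝ => x + s • e) e t := by
  simpa using ((hasDerivAt_id t).smul_const e).const_add x

theorem tendsto_line (x e : V) : Filter.Tendsto (fun s : ℝ => x + s • e) (𝓝 0) (𝓝 x) := by
  simpa using (hasDerivAt_line x e 0).continuousAt.tendsto

theorem isLocalMax_comp_line {g : V → ℝ} (h : IsLocalMax g x) (e : V) :
    IsLocalMax (fun s : ℝ => g (x + s • e)) 0 := by
  filter_upwards [(tendsto_line x e).eventually h] with s hs
  simpa using hs

theorem hasFDerivAt_fderiv (hf : ContDiffAt ℝ 2 f x) :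
    HasFDerivAt (fderiv ℝ f) (fderiv ℝ (fderiv ℝ f) x) x :=
  ((hf.fderiv_right (m := 1) (by norm_num)).differentiableAt one_ne_zero).hasFDerivAt

theorem hasDerivAt_fderiv_apply_line {Ψ : V → V →L[ℝ] F} {Ψ' : V →L[ℝ] V →L[ℝ] F}
    (hΨ : HasFDerivAt Ψ Ψ' x) (ξ v : V) :
    HasDerivAt (fun s : ℝ => Ψ (x + s • ξ) v) (Ψ' ξ v) 0 := by
  simpa using HasDerivAt.clm_apply (hΨ.hasLineDerivAt ξ) (hasDerivAt_const (0 : ℝ) v)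

/-- The curve `f` has the first derivative `f'` and the second derivative `f''` at `t`. -/
def HasSndDerivAt (f : ℝ → F) (f' f'' : F) (t : ℝ) : Prop :=
  ∃ g : ℝ → F, (∀ᶠ s in 𝓝 t, HasDerivAt f (g s) s) ∧ g t = f' ∧ HasDerivAt g f'' t

theorem hasSndDerivAt_line (x e : V) (t : ℝ) : HasSndDerivAt (fun s : ℝ => x + s • e) e 0 t :=
  ⟨fun _ => e, .of_forall (hasDerivAt_line x e), rfl, hasDerivAt_const t e⟩

theorem hasSndDerivAt_comp_line (hf : ContDiffAt ℝ 2 f x) (e : V) :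
    HasSndDerivAt (fun s : ℝ => f (x + s • e)) (fderiv ℝ f x e) (fderiv ℝ (fderiv ℝ f) x e e)
      0 := by
  refine ⟨fun s => fderiv ℝ f (x + s • e) e, ?_, by simp,
    hasDerivAt_fderiv_apply_line (hasFDerivAt_fderiv hf) e e⟩
  filter_upwards [(tendsto_line x e).eventually (hf.eventually (by simp))] with s hs
  exact (hs.differentiableAt two_ne_zero).hasFDerivAt.comp_hasDerivAt s (hasDerivAt_line x e s)

namespace HasSndDerivAt

variable {f₁ f₂ : ℝ → F} {f₁' f₁'' f₂' f₂'' : F}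

theorem unique_snd (h₁ : HasSndDerivAt f₁ f₁' f₁'' t) (h₂ : HasSndDerivAt f₁ f₂' f₂'' t) :
    f₁'' = f₂'' := by
  obtain ⟨g₁, hg₁, -, hd₁⟩ := h₁
  obtain ⟨g₂, hg₂, -, hd₂⟩ := h₂
  refine hd₁.unique (hd₂.congr_of_eventuallyEq ?_)
  filter_upwards [hg₁, hg₂] with s h₁ h₂ using h₁.unique h₂

theorem add (h₁ : HasSndDerivAt f₁ f₁' f₁'' t) (h₂ : HasSndDerivAt f₂ f₂' f₂'' t) :
    HasSndDerivAt (fun s => f₁ s + f₂ s) (f₁' + f₂') (f₁'' + f₂'') t := by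
  obtain ⟨g₁, hg₁, rfl, hd₁⟩ := h₁
  obtain ⟨g₂, hg₂, rfl, hd₂⟩ := h₂
  refine ⟨fun s => g₁ s + g₂ s, ?_, rfl, hd₁.add hd₂⟩
  filter_upwards [hg₁, hg₂] with s h₁ h₂ using h₁.add h₂

theorem clm_comp {G : Type*} [NormedAddCommGroup G] [NormedSpace ℝ G] (L : F →L[ℝ] G)
    (h : HasSndDerivAt f₁ f₁' f₁'' t) :
    HasSndDerivAt (fun s => L (f₁ s)) (L f₁') (L f₁'') t := by
  obtain ⟨g, hg, rfl, hd⟩ := h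
  exact ⟨fun s => L (g s), hg.mono fun s hs => L.hasFDerivAt.comp_hasDerivAt s hs, rfl,
    L.hasFDerivAt.comp_hasDerivAt t hd⟩

theorem const_smul (c : ℝ) (h : HasSndDerivAt f₁ f₁' f₁'' t) :
    HasSndDerivAt (fun s => c • f₁ s) (c • f₁') (c • f₁'') t :=
  h.clm_comp (c • ContinuousLinearMap.id ℝ F)

theorem sub (h₁ : HasSndDerivAt f₁ f₁' f₁'' t) (h₂ : HasSndDerivAt f₂ f₂' f₂'' t) :
    HasSndDerivAt (fun s => f₁ s - f₂ s) (f₁' - f₂') (f₁'' - f₂'') t := by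
  simpa [sub_eq_add_neg] using h₁.add (h₂.const_smul (-1))

theorem smul {b : ℝ → ℝ} {b' b'' : ℝ} (hb : HasSndDerivAt b b' b'' t)
    (h : HasSndDerivAt f₁ f₁' f₁'' t) :
    HasSndDerivAt (fun s => b s • f₁ s) (b t • f₁' + b' • f₁ t)
      (b'' • f₁ t + (2 * b') • f₁' + b t • f₁'') t := by
  obtain ⟨c, hc, rfl, hdc⟩ := hb
  obtain ⟨g, hg, rfl, hd⟩ := h
  refine ⟨fun s => b s • g s + c s • f₁ s, ?_, rfl, ?_⟩
  · filter_upwards [hc, hg] with s hcs hgs using hcs.smul hgs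
  · refine ((hc.self_of_nhds.smul hd).add (hdc.smul hg.self_of_nhds)).congr_deriv ?_
    module

theorem norm_sq {V : Type*} [NormedAddCommGroup V] [InnerProductSpace ℝ V] {f : ℝ → V}
    {f' f'' : V} (h : HasSndDerivAt f f' f'' t) :
    HasSndDerivAt (fun s => ‖f s‖ ^ 2) (2 * ⟪f t, f'⟫) (2 * (‖f'‖ ^ 2 + ⟪f t, f''⟫)) t := by
  obtain ⟨g, hg, rfl, hd⟩ := h
  refine ⟨fun s => 2 * ⟪f s, g s⟫, hg.mono fun s hs => hs.norm_sq, rfl, ?_⟩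
  refine ((hg.self_of_nhds.inner ℝ hd).const_mul 2).congr_deriv ?_
  rw [real_inner_self_eq_norm_sq]
  ring

theorem nonpos_of_isLocalMax {f : ℝ → ℝ} {f' f'' : ℝ} (h : HasSndDerivAt f f' f'' t)
    (hmax : IsLocalMax f t) : f'' ≤ 0 := by
  obtain ⟨g, hg, -, hd⟩ := h
  by_contra! hpos
  have hderiv : deriv f =ᶠ[𝓝 t] g := hg.mono fun s hs => hs.deriv
  have hsnd : deriv (deriv f) t = f'' := hderiv.deriv_eq.trans hd.deriv
  have hmin : IsLocalMin f t :=
    isLocalMin_of_deriv_deriv_pos (hsnd ▸ hpos) hmax.deriv_eq_zero hg.self_of_nhds.continuousAt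
  have hconst : f =ᶠ[𝓝 t] fun _ => f t := by
    filter_upwards [hmax, hmin] with s hs₁ hs₂ using le_antisymm hs₁ hs₂
  have hzero : deriv (deriv f) t = 0 := by simpa using hconst.deriv.deriv_eq
  exact hpos.ne' (hsnd.symm.trans hzero)

end HasSndDerivAt

theorem third_fderiv_symm {u : V → ℝ} (hu : ContDiffAt ℝ 3 u x) (e v : V) :
    fderiv ℝ (fderiv ℝ (fderiv ℝ u)) x e e v = fderiv ℝ (fderiv ℝ (fderiv ℝ u)) x v e e := by
  have hDu : ContDiffAt ℝ 2 (fderiv ℝ u) x := hu.fderiv_right (by norm_num)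
  have hline : ∀ v w, HasDerivAt (fun s : ℝ => fderiv ℝ (fderiv ℝ u) (x + s • e) v w)
      (fderiv ℝ (fderiv ℝ (fderiv ℝ u)) x e v w) 0 := fun v w => by
    simpa using (hasDerivAt_fderiv_apply_line (hasFDerivAt_fderiv hDu) e v).clm_apply
      (hasDerivAt_const (0 : ℝ) w)
  have hsymm : (fun s : ℝ => fderiv ℝ (fderiv ℝ u) (x + s • e) e v) =ᶠ[𝓝 0]
      fun s => fderiv ℝ (fderiv ℝ u) (x + s • e) v e := by
    filter_upwards [(tendsto_line x e).eventually (hu.eventually (by simp))] with s hs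
    exact (hs.of_le (by norm_num)).isSymmSndFDerivAt (n := 2) (by simp) e v
  rw [(hline e v).unique ((hline v e).congr_of_eventuallyEq hsymm),
    hDu.isSymmSndFDerivAt (by simp) e v]

end Line

/-! ### The linearized equation -/

/-- The bound for the normalized linearized operator applied to a solution and its derivatives. -/
def linConst (k : ℕ) (a A : ℝ) : ℝ := k * A * (k * (1 + k * A) / a) ^ 2

namespace IsDiagonalSolution

variable {ι : Type*} [Fintype ι] [DecidableEq ι] {k : ℕ} {α : Fin k → ℝ} {lam : ι → ℝ}
  {a A : ℝ}

theorem sum_mixedCoeff_pos (h : IsDiagonalSolution α lam) (ha : 0 < a) (hαa : ∀ l, a ≤ α l)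
    (hαA : ∀ l, α l ≤ A) : 0 < ∑ i, mixedCoeff α lam i := by
  have hpos : 0 < ∑ l : Fin k, esym l lam := by
    obtain ⟨j, rfl⟩ := h.exists_eq_succ
    exact Finset.sum_pos (fun l _ => h.esym_pos l l.2.le) Finset.univ_nonempty
  by_contra! hle
  exact (hpos.trans_le (h.sum_esym_le ha hαa hαA)).not_ge
    (mul_nonpos_of_nonneg_of_nonpos (sq_nonneg _) hle)

theorem abs_sum_div_mul_le (h : IsDiagonalSolution α lam) (ha : 0 < a) (hαa : ∀ l, a ≤ α l)
    (hαA : ∀ l, α l ≤ A) {g : ι → ℝ} {c : ℝ} (hc : 0 ≤ c)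
    (hg : |∑ i, mixedCoeff α lam i * g i| ≤ k * A * c * ∑ l : Fin k, esym l lam) :
    |∑ i, mixedCoeff α lam i / (∑ j, mixedCoeff α lam j) * g i| ≤ linConst k a A * c := by
  have hT := h.sum_mixedCoeff_pos ha hαa hαA
  have hA : 0 ≤ A := by
    obtain ⟨j, rfl⟩ := h.exists_eq_succ
    exact ha.le.trans ((hαa 0).trans (hαA 0))
  simp only [div_mul_eq_mul_div]
  rw [← Finset.sum_div, abs_div, abs_of_pos hT, div_le_iff₀ hT]
  calc |∑ i, mixedCoeff α lam i * g i| ≤ k * A * c * ∑ l : Fin k, esym l lam := hg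
    _ ≤ k * A * c * ((k * (1 + k * A) / a) ^ 2 * ∑ i, mixedCoeff α lam i) := by
        gcongr
        exact h.sum_esym_le ha hαa hαA
    _ = linConst k a A * c * ∑ i, mixedCoeff α lam i := by rw [linConst]; ring

end IsDiagonalSolution

section Linearized

variable {n k : ℕ} {Ω : Set (E n)} {α : Fin k → E n → ℝ} {u : E n → ℝ} {a A : ℝ} {x : E n}
  {e : OrthonormalBasis (Fin n) ℝ (E n)} {lam : Fin n → ℝ}

theorem hasDerivAt_formMatrix_line (hu : ContDiffAt ℝ 3 u x) (ξ : E n) (i j : Fin n) :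
    HasDerivAt (fun s : ℝ => formMatrix (fderiv ℝ (fderiv ℝ u) (x + s • ξ)) e i j)
      (formMatrix (fderiv ℝ (fderiv ℝ (fderiv ℝ u)) x ξ) e i j) 0 := by
  have hD := hasFDerivAt_fderiv (hu.fderiv_right (m := 2) (by norm_num))
  simpa [formMatrix] using (hasDerivAt_fderiv_apply_line hD ξ (e i)).clm_apply
    (hasDerivAt_const (0 : ℝ) (e j))

theorem hasDerivAt_sigma_hessian (hu : ContDiffAt ℝ 3 u x)
    (h : formMatrix (fderiv ℝ (fderiv ℝ u) x) e = Matrix.diagonal lam) {m : ℕ} (hm : m ≤ n)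
    (ξ : E n) :
    HasDerivAt (fun s : ℝ => sigma m (hessian u (x + s • ξ)))
      (∑ i, esymDeriv m lam i * fderiv ℝ (fderiv ℝ (fderiv ℝ u)) x ξ (e i) (e i)) 0 := by
  cases m with
  | zero => simpa [esymDeriv, sigma, esymm_zero] using hasDerivAt_const (0 : ℝ) (1 : ℝ)
  | succ m =>
    have hcoeff : (fun s : ℝ => sigma (m + 1) (hessian u (x + s • ξ))) =ᶠ[𝓝 0] fun s =>
        (-1) ^ (m + 1) *
          (formMatrix (fderiv ℝ (fderiv ℝ u) (x + s • ξ)) e).charpoly.coeff (n - (m + 1)) := by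
      filter_upwards [(tendsto_line x ξ).eventually (hu.eventually (by simp))] with s hs
      rw [sigma_hessian_eq_coeff
        ((hs.of_le (by norm_num)).isSymmSndFDerivAt (n := 2) (by simp)) hm, charpoly_hessian _ _ e]
    have hderiv := (hasDerivAt_charpoly_coeff (hasDerivAt_formMatrix_line (e := e) hu ξ)
      (by simpa using h) (n - (m + 1))).const_mul ((-1 : ℝ) ^ (m + 1))
    refine (hderiv.congr_of_eventuallyEq hcoeff).congr_deriv ?_
    rw [← Finset.sum_neg_distrib, Finset.mul_sum]
    refine Finset.sum_congr rfl fun i _ => ?_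
    have hprod := coeff_prod_erase_X_sub_C lam i (m := m) (by rw [Fintype.card_fin]; omega)
    rw [Fintype.card_fin] at hprod
    have hsign : ((-1 : ℝ) ^ m) * (-1) ^ m = 1 := by rw [← mul_pow]; simp
    rw [hprod, formMatrix, Matrix.of_apply, esymDeriv, pow_succ]
    linear_combination (esymErase m lam i *
      fderiv ℝ (fderiv ℝ (fderiv ℝ u)) x ξ (e i) (e i)) * hsign

theorem sum_mixedCoeff_mul_third_fderiv (hΩ : IsOpen Ω) (hx : x ∈ Ω) (hu : ContDiffAt ℝ 3 u x)
    (heq : ∀ x ∈ Ω, sigma k (hessian u x) = ∑ l : Fin k, α l x * sigma (l : ℕ) (hessian u x))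
    (hα : ∀ l, DifferentiableAt ℝ (α l) x) (hkn : k ≤ n)
    (h : formMatrix (fderiv ℝ (fderiv ℝ u) x) e = Matrix.diagonal lam) (ξ : E n) :
    ∑ i, mixedCoeff (fun l => α l x) lam i * fderiv ℝ (fderiv ℝ (fderiv ℝ u)) x ξ (e i) (e i)
      = ∑ l : Fin k, fderiv ℝ (α l) x ξ * esym l lam := by
  have hleft := hasDerivAt_sigma_hessian hu h hkn ξ
  have hright := HasDerivAt.fun_sum (u := Finset.univ) fun (l : Fin k) _ =>
    HasDerivAt.mul ((hα l).hasFDerivAt.hasLineDerivAt ξ)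
      (hasDerivAt_sigma_hessian hu h (l.2.le.trans hkn) ξ)
  have hev : (fun s : ℝ => sigma k (hessian u (x + s • ξ))) =ᶠ[𝓝 0]
      fun s => ∑ l : Fin k, α l (x + s • ξ) * sigma (l : ℕ) (hessian u (x + s • ξ)) := by
    filter_upwards [(tendsto_line x ξ).eventually (hΩ.mem_nhds hx)] with s hs using heq _ hs
  have hderiv := hleft.unique (hright.congr_of_eventuallyEq hev)
  simp only [zero_smul, add_zero, sigma_hessian h, Finset.sum_add_distrib] at hderiv
  simp only [mixedCoeff, sub_mul, Finset.sum_sub_distrib, Finset.sum_mul]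
  rw [hderiv, Finset.sum_comm]
  simp only [Finset.mul_sum, mul_assoc, add_sub_cancel_right]

/-- The bounds on the coefficients of the equation at `x`. -/
structure CoeffBoundsAt (α : Fin k → E n → ℝ) (a A : ℝ) (x : E n) : Prop where
  differentiableAt : ∀ l, DifferentiableAt ℝ (α l) x
  le_apply : ∀ l, a ≤ α l x
  apply_le : ∀ l, α l x ≤ A
  norm_fderiv_le : ∀ l, ‖fderiv ℝ (α l) x‖ ≤ A

/-- Directions `e i` and weights `w i` for which the operator `v ↦ ∑ i, w i D²v(e i, e i)`, a
linearization of the equation normalized to have trace one, maps `u` and the derivatives of `u` at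
`x` to functions bounded by `C`. -/
structure IsLinearizedFrame {V : Type*} [NormedAddCommGroup V] [NormedSpace ℝ V] {ι : Type*}
    [Fintype ι] (u : V → ℝ) (x : V) (C : ℝ) (e : ι → V) (w : ι → ℝ) : Prop where
  norm_eq_one : ∀ i, ‖e i‖ = 1
  nonneg : ∀ i, 0 ≤ w i
  sum_eq_one : ∑ i, w i = 1
  abs_snd_le : |∑ i, w i * fderiv ℝ (fderiv ℝ u) x (e i) (e i)| ≤ C
  abs_third_le : ∀ ξ, |∑ i, w i * fderiv ℝ (fderiv ℝ (fderiv ℝ u)) x ξ (e i) (e i)| ≤ C * ‖ξ‖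

theorem abs_sum_fderiv_mul_esym_le (h : IsDiagonalSolution (fun l => α l x) lam)
    (hα : ∀ l, ‖fderiv ℝ (α l) x‖ ≤ A) (ξ : E n) :
    |∑ l : Fin k, fderiv ℝ (α l) x ξ * esym l lam|
      ≤ k * A * ‖ξ‖ * ∑ l : Fin k, esym l lam := by
  have hk : (1 : ℝ) ≤ k := by
    obtain ⟨j, rfl⟩ := h.exists_eq_succ
    exact_mod_cast Nat.succ_le_succ (Nat.zero_le j)
  calc |∑ l : Fin k, fderiv ℝ (α l) x ξ * esym l lam|
      ≤ ∑ l : Fin k, |fderiv ℝ (α l) x ξ * esym l lam| := Finset.abs_sum_le_sum_abs _ _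
    _ ≤ ∑ l : Fin k, k * A * ‖ξ‖ * esym l lam := by
        refine Finset.sum_le_sum fun l _ => ?_
        have hl := (h.esym_pos l l.2.le).le
        have hA : 0 ≤ A := (norm_nonneg _).trans (hα l)
        rw [abs_mul, abs_of_nonneg hl]
        gcongr
        calc |fderiv ℝ (α l) x ξ| ≤ A * ‖ξ‖ := (fderiv ℝ (α l) x).le_of_opNorm_le (hα l) ξ
          _ ≤ k * A * ‖ξ‖ := by gcongr; exact le_mul_of_one_le_left hA hk
    _ = k * A * ‖ξ‖ * ∑ l : Fin k, esym l lam := by rw [Finset.mul_sum]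

theorem exists_isLinearizedFrame (hΩ : IsOpen Ω) (ha : 0 < a) (hx : x ∈ Ω)
    (hu : ContDiffOn ℝ 3 u Ω) (hadm : IsAdmissible k Ω u)
    (heq : ∀ x ∈ Ω, sigma k (hessian u x) = ∑ l : Fin k, α l x * sigma (l : ℕ) (hessian u x))
    (hα : CoeffBoundsAt α a A x) :
    ∃ (e : Fin n → E n) (w : Fin n → ℝ), IsLinearizedFrame u x (linConst k a A) e w := by
  have hux : ContDiffAt ℝ 3 u x := hu.contDiffAt (hΩ.mem_nhds hx)
  obtain ⟨e, lam, hdiag, h⟩ := exists_eigenbasis hx (hux.of_le (by norm_num)) hadm heq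
  have hα₀ : ∀ l, 0 ≤ α l x := fun l => ha.le.trans (hα.le_apply l)
  have hT := h.sum_mixedCoeff_pos ha hα.le_apply hα.apply_le
  have hkn : k ≤ n := h.le_card.trans_eq (Fintype.card_fin n)
  have hlam : ∀ i, fderiv ℝ (fderiv ℝ u) x (e i) (e i) = lam i := fun i => by
    simpa [formMatrix] using congrFun (congrFun hdiag i) i
  refine ⟨e, fun i => mixedCoeff (fun l => α l x) lam i / ∑ j, mixedCoeff (fun l => α l x) lam j,
    fun i => e.orthonormal.1 i, fun i => div_nonneg (h.mixedCoeff_nonneg hα₀ i) hT.le, ?_, ?_,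
    fun ξ => ?_⟩
  · rw [← Finset.sum_div, div_self hT.ne']
  · simp only [hlam]
    simpa using h.abs_sum_div_mul_le ha hα.le_apply hα.apply_le zero_le_one (g := lam)
      (by simpa [mul_comm] using h.abs_sum_mul_mixedCoeff_le hα₀ hα.apply_le)
  · refine h.abs_sum_div_mul_le ha hα.le_apply hα.apply_le (norm_nonneg ξ) ?_
    rw [sum_mixedCoeff_mul_third_fderiv hΩ hx hux heq hα.differentiableAt hkn hdiag]
    exact abs_sum_fderiv_mul_esym_le h hα.norm_fderiv_le ξ

end Linearized

/-! ### The outer unit normal -/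

section Normal

theorem inter_frontier_nonempty_of_isPreconnected {X : Type*} [TopologicalSpace X] {s t : Set X}
    (ht : IsPreconnected t) (hts : (t ∩ s).Nonempty) (hts' : (t \ s).Nonempty) :
    (t ∩ frontier s).Nonempty := by
  by_contra hempty
  have hcover : t ⊆ interior s ∪ (closure s)ᶜ := fun z hz => by
    by_contra hz'
    rw [Set.mem_union, not_or, Set.mem_compl_iff, not_not] at hz'
    exact hempty ⟨z, hz, hz'.2, hz'.1⟩
  obtain ⟨x, hxt, hxs⟩ := hts
  obtain ⟨y, hyt, hys⟩ := hts'
  have hx : x ∈ interior s := (hcover hxt).resolve_right (not_not.2 (subset_closure hxs))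
  have hy : y ∈ (closure s)ᶜ := (hcover hyt).resolve_left fun h => hys (interior_subset h)
  obtain ⟨z, -, hz, hz'⟩ := ht _ _ isOpen_interior isClosed_closure.isOpen_compl hcover
    ⟨x, hxt, hx⟩ ⟨y, hyt, hy⟩
  exact hz' (subset_closure (interior_subset hz))

variable {n m : ℕ} {Ω : Set (E n)} {p ν v τ : E n} {ρ : E n → ℝ}

theorem contDiffAt_gradient (hρ : ContDiffAt ℝ (m + 1 : ℕ) ρ p) :
    ContDiffAt ℝ m (gradient ρ) p :=
  riesz.contDiff.contDiffAt.comp p (hρ.fderiv_right (by norm_cast))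

namespace IsLocalDefiningFunction

theorem of_le {m' : ℕ} (h : IsLocalDefiningFunction m Ω p ρ) (hm : m' ≤ m) :
    IsLocalDefiningFunction m' Ω p ρ :=
  ⟨h.contDiffAt.of_le (by exact_mod_cast hm), h.apply_eq_zero, h.gradient_ne_zero, h.mem_iff⟩

theorem tendsto_inv_smul (h : IsLocalDefiningFunction 1 Ω p ρ) (v : E n) :
    Filter.Tendsto (fun t : ℝ => t⁻¹ • ρ (p + t • v)) (𝓝[>] 0) (𝓝 ⟪gradient ρ p, v⟫) := by
  have hd := (h.contDiffAt.differentiableAt (by simp)).hasFDerivAt.hasLineDerivAt v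
  simpa [h.apply_eq_zero] using HasDerivAt.tendsto_slope_zero_right hd

theorem eventually_mem_iff (h : IsLocalDefiningFunction m Ω p ρ) (v : E n) :
    ∀ᶠ t : ℝ in 𝓝[>] 0, p + t • v ∈ Ω ↔ ρ (p + t • v) < 0 :=
  ((tendsto_line p v).eventually h.mem_iff).filter_mono nhdsWithin_le_nhds

theorem eventually_mem (h : IsLocalDefiningFunction 1 Ω p ρ) (hv : ⟪gradient ρ p, v⟫ < 0) :
    ∀ᶠ t : ℝ in 𝓝[>] 0, p + t • v ∈ Ω := by
  filter_upwards [(h.tendsto_inv_smul v).eventually_lt_const hv, h.eventually_mem_iff v,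
    self_mem_nhdsWithin] with t hslope hmem (ht : 0 < t)
  exact hmem.2 (neg_of_mul_neg_right hslope (inv_pos.2 ht).le)

theorem eventually_notMem (h : IsLocalDefiningFunction 1 Ω p ρ) (hv : 0 < ⟪gradient ρ p, v⟫) :
    ∀ᶠ t : ℝ in 𝓝[>] 0, p + t • v ∉ Ω := by
  filter_upwards [(h.tendsto_inv_smul v).eventually_const_lt hv, h.eventually_mem_iff v,
    self_mem_nhdsWithin] with t hslope hmem (ht : 0 < t)
  rw [hmem, not_lt]
  exact (pos_of_mul_pos_right hslope (inv_pos.2 ht).le).le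

theorem eventually (h : IsLocalDefiningFunction (m + 1) Ω p ρ) (hΩ : IsOpen Ω) :
    ∀ᶠ q in 𝓝 p, ContDiffAt ℝ (m + 1 : ℕ) ρ q ∧ gradient ρ q ≠ 0 ∧
      (q ∈ frontier Ω → IsLocalDefiningFunction (m + 1) Ω q ρ) := by
  filter_upwards [h.contDiffAt.eventually (by simp),
    (contDiffAt_gradient h.contDiffAt).continuousAt.eventually_ne h.gradient_ne_zero,
    h.mem_iff.eventually_nhds] with q hsmooth hgrad hmem
  refine ⟨hsmooth, hgrad, fun hq => ⟨hsmooth, le_antisymm ?_ ?_, hgrad, hmem⟩⟩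
  · by_contra! hpos
    obtain ⟨x, ⟨hxΩ, hx⟩, hx'⟩ := ((mem_closure_iff_frequently.1 hq.1).and_eventually
      hmem).and_eventually (hsmooth.continuousAt.eventually (lt_mem_nhds hpos)) |>.exists
    exact lt_asymm (hx.1 hxΩ) hx'
  · rw [← not_lt, ← hmem.self_of_nhds]
    exact fun hqΩ => hq.2 (hΩ.interior_eq.symm ▸ hqΩ)

theorem isOuterUnitNormal (h : IsLocalDefiningFunction 1 Ω p ρ) :
    IsOuterUnitNormal Ω p (‖gradient ρ p‖⁻¹ • gradient ρ p) :=
  ⟨ρ, h, rfl⟩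

end IsLocalDefiningFunction

namespace IsOuterUnitNormal

theorem norm_eq_one (h : IsOuterUnitNormal Ω p ν) : ‖ν‖ = 1 := by
  obtain ⟨ρ, hρ, rfl⟩ := h
  rw [norm_smul, norm_inv, norm_norm, inv_mul_cancel₀ (norm_ne_zero_iff.2 hρ.gradient_ne_zero)]

theorem eventually_mem (h : IsOuterUnitNormal Ω p ν) (hv : ⟪ν, v⟫ < 0) :
    ∀ᶠ t : ℝ in 𝓝[>] 0, p + t • v ∈ Ω := by
  obtain ⟨ρ, hρ, rfl⟩ := h
  rw [real_inner_smul_left] at hv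
  exact hρ.eventually_mem (neg_of_mul_neg_right hv (by positivity))

theorem eventually_notMem (h : IsOuterUnitNormal Ω p ν) (hv : 0 < ⟪ν, v⟫) :
    ∀ᶠ t : ℝ in 𝓝[>] 0, p + t • v ∉ Ω := by
  obtain ⟨ρ, hρ, rfl⟩ := h
  rw [real_inner_smul_left] at hv
  exact hρ.eventually_notMem (pos_of_mul_pos_right hv (by positivity))

theorem unique {ν' : E n} (h : IsOuterUnitNormal Ω p ν) (h' : IsOuterUnitNormal Ω p ν') :
    ν = ν' := by
  by_contra hne
  have hlt : ⟪ν, ν'⟫ < 1 :=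
    (inner_lt_one_iff_real_of_norm_eq_one h.norm_eq_one h'.norm_eq_one).2 hne
  have hin : ⟪ν, ν' - ν⟫ < 0 := by
    rw [inner_sub_right, real_inner_self_eq_norm_sq, h.norm_eq_one]; linarith
  have hout : 0 < ⟪ν', ν' - ν⟫ := by
    rw [inner_sub_right, real_inner_self_eq_norm_sq, h'.norm_eq_one, real_inner_comm]; linarith
  obtain ⟨t, hmem, hnot⟩ := ((h.eventually_mem hin).and (h'.eventually_notMem hout)).exists
  exact hnot hmem

/-- The boundary is met on the segment between `p + t(τ - δν) ∈ Ω` and `p + t(τ + δν) ∉ Ω`. -/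
theorem exists_mem_frontier (h : IsOuterUnitNormal Ω p ν) (hτ : ⟪ν, τ⟫ = 0) {δ : ℝ} (hδ : 0 < δ) :
    ∃ t s : ℝ, 0 < t ∧ t ≤ δ ∧ |s| ≤ δ ∧ p + t • (τ + s • ν) ∈ frontier Ω := by
  have hinner : ∀ s : ℝ, ⟪ν, τ + s • ν⟫ = s := fun s => by
    simp [inner_add_right, real_inner_smul_right, hτ, h.norm_eq_one]
  obtain ⟨t, ⟨hin, hout⟩, ht, htδ⟩ :=
    ((h.eventually_mem (v := τ + (-δ) • ν) (by rwa [hinner, neg_lt_zero])).and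
      (h.eventually_notMem (v := τ + δ • ν) (by rwa [hinner]))).and (Ioo_mem_nhdsGT hδ) |>.exists
  obtain ⟨_, ⟨a, b, ha, hb, hab, rfl⟩, hmem⟩ := inter_frontier_nonempty_of_isPreconnected
    (convex_segment (𝕜 := ℝ) _ _).isPreconnected ⟨_, left_mem_segment ℝ _ _, hin⟩
    ⟨_, right_mem_segment ℝ _ _, hout⟩
  refine ⟨t, (b - a) * δ, ht, htδ.le, ?_, ?_⟩
  · rw [abs_mul, abs_of_pos hδ]
    exact mul_le_of_le_one_left hδ.le (abs_le.2 ⟨by linarith, by linarith⟩)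
  · obtain rfl : a = 1 - b := by linarith
    convert hmem using 1
    module

theorem mem_tangentConeAt (h : IsOuterUnitNormal Ω p ν) (hτ : ⟪ν, τ⟫ = 0) :
    τ ∈ tangentConeAt ℝ (frontier Ω) p := by
  choose t s ht0 ht hs hmem using fun i : ℕ =>
    h.exists_mem_frontier hτ (Nat.one_div_pos_of_nat (α := ℝ) (n := i))
  have hlim := tendsto_one_div_add_atTop_nhds_zero_nat (𝕜 := ℝ)
  have htlim : Filter.Tendsto t Filter.atTop (𝓝 0) := squeeze_zero (fun i => (ht0 i).le) ht hlim
  have hslim : Filter.Tendsto s Filter.atTop (𝓝 0) := squeeze_zero_norm hs hlim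
  have hvlim : Filter.Tendsto (fun i => τ + s i • ν) Filter.atTop (𝓝 τ) := by
    simpa using tendsto_const_nhds.add (hslim.smul_const ν)
  refine mem_tangentConeAt_of_seq Filter.atTop (fun i => (t i)⁻¹)
    (fun i => t i • (τ + s i • ν)) ?_ (.of_forall hmem) ?_
  · simpa using htlim.smul hvlim
  · exact hvlim.congr fun i => (inv_smul_smul₀ (ht0 i).ne' _).symm

theorem apply_eq_zero_of_eventuallyEq (h : IsOuterUnitNormal Ω p ν) (hp : p ∈ frontier Ω)
    (hτ : ⟪ν, τ⟫ = 0) {f : E n → ℝ} {f' : E n →L[ℝ] ℝ}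
    (hf : HasFDerivWithinAt f f' (frontier Ω) p) (h0 : f =ᶠ[𝓝[frontier Ω] p] fun _ => 0) :
    f' τ = 0 := by
  have hzero : HasFDerivWithinAt f (0 : E n →L[ℝ] ℝ) (frontier Ω) p :=
    (hasFDerivWithinAt_const (0 : ℝ) p _).congr_of_eventuallyEq h0 (h0.self_of_nhdsWithin hp)
  simpa using hf.unique_on hzero (h.mem_tangentConeAt hτ)

theorem apply_nonneg_of_isMaxOn (h : IsOuterUnitNormal Ω p ν) (hconv : Convex ℝ Ω)
    (hp : p ∈ frontier Ω) {f : E n → ℝ} {f' : E n →L[ℝ] ℝ}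
    (hf : HasFDerivWithinAt f f' (closure Ω) p) (hmax : IsMaxOn f (closure Ω) p) : 0 ≤ f' ν := by
  have hinward : ⟪ν, -ν⟫ < 0 := by simp [h.norm_eq_one]
  obtain ⟨t, hmem, ht : 0 < t⟩ := ((h.eventually_mem hinward).and self_mem_nhdsWithin).exists
  have hseg : segment ℝ p (p + t • (-ν)) ⊆ closure Ω :=
    hconv.closure.segment_subset hp.1 (subset_closure hmem)
  have hle := hmax.localize.hasFDerivWithinAt_nonpos hf
    (mem_posTangentConeAt_of_segment_subset hseg)
  rw [map_smul, map_neg, smul_eq_mul, mul_neg, neg_nonpos] at hle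
  exact nonneg_of_mul_nonneg_right hle ht

end IsOuterUnitNormal

/-! ### Curvature of the boundary -/

theorem exists_contDiff_forall_isOuterUnitNormal (hΩ : IsOpen Ω)
    (hρ : ∀ p ∈ frontier Ω, ∃ ρ, IsLocalDefiningFunction (m + 1) Ω p ρ) :
    ∃ N : E n → E n, ContDiff ℝ m N ∧ ∀ p ∈ frontier Ω, IsOuterUnitNormal Ω p (N p) := by
  set normals : E n → Set (E n) := fun x => {ν | x ∈ frontier Ω → IsOuterUnitNormal Ω x ν}
  have hconv : ∀ x, Convex ℝ (normals x) := fun x => by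
    by_cases hx : x ∈ frontier Ω
    · exact Set.Subsingleton.convex fun ν hν ν' hν' => (hν hx).unique (hν' hx)
    · simp [normals, hx, convex_univ]
  obtain ⟨N, hN⟩ := exists_contMDiffMap_forall_mem_convex_of_local
    (modelWithCornersSelf ℝ (E n)) (n := (m : ℕ∞)) hconv fun x => by
      by_cases hx : x ∈ frontier Ω
      · obtain ⟨ρ, hρx⟩ := hρ x hx
        refine ⟨_, hρx.eventually hΩ, fun y => ‖gradient ρ y‖⁻¹ • gradient ρ y, ?_,
          fun y hy hyΩ => ((hy.2.2 hyΩ).of_le (by lia)).isOuterUnitNormal⟩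
        rw [contMDiffOn_iff_contDiffOn]
        rintro y ⟨hsmooth, hgrad, -⟩
        have hgr := contDiffAt_gradient hsmooth
        exact (((hgr.norm ℝ hgrad).inv (norm_ne_zero_iff.2 hgrad)).smul hgr).contDiffWithinAt
      · exact ⟨(frontier Ω)ᶜ, isClosed_frontier.isOpen_compl.mem_nhds hx, fun _ => 0,
          contMDiffOn_const, fun y hy hyΩ => absurd hyΩ hy⟩
  exact ⟨N, N.contMDiff.contDiff, hN⟩

variable {N : E n → E n}

/-- Differentiate `Dρ(q) τ = |Dρ(q)| ⟪N q, τ⟫` along the boundary. -/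
theorem snd_fderiv_eq_mul_inner_fderiv_normal (hΩ : IsOpen Ω) (hN : ContDiff ℝ 1 N)
    (hNν : ∀ p ∈ frontier Ω, IsOuterUnitNormal Ω p (N p)) (hp : p ∈ frontier Ω)
    (hρ : IsLocalDefiningFunction 2 Ω p ρ) (hτ : ⟪N p, τ⟫ = 0) :
    fderiv ℝ (fderiv ℝ ρ) p τ τ = ‖gradient ρ p‖ * ⟪fderiv ℝ N p τ, τ⟫ := by
  have hd := ((hasFDerivAt_fderiv hρ.contDiffAt).clm_apply (hasFDerivAt_const τ p)).sub
    ((((contDiffAt_gradient (m := 1) hρ.contDiffAt).norm ℝ hρ.gradient_ne_zero).differentiableAt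
      one_ne_zero).hasFDerivAt.mul
      ((hN.differentiable one_ne_zero p).hasFDerivAt.inner ℝ (hasFDerivAt_const τ p)))
  have hzero := (hNν p hp).apply_eq_zero_of_eventuallyEq hp hτ hd.hasFDerivWithinAt (by
    filter_upwards [nhdsWithin_le_nhds (hρ.eventually (m := 1) hΩ), self_mem_nhdsWithin]
      with q hq hqΩ
    obtain ⟨-, hgrad, hq⟩ := hq
    have hNq := (hNν q hqΩ).unique ((hq hqΩ).of_le one_le_two).isOuterUnitNormal
    change fderiv ℝ ρ q τ - ‖gradient ρ q‖ * ⟪N q, τ⟫ = 0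
    rw [hNq, real_inner_smul_left, mul_inv_cancel_left₀ (norm_ne_zero_iff.2 hgrad),
      inner_gradient_left, sub_self])
  simpa [hτ, sub_eq_zero] using hzero

theorem IsStrictlyConvexDomain.inner_fderiv_normal_pos (hΩ : IsStrictlyConvexDomain m Ω)
    (hm : 2 ≤ m) (hN : ContDiff ℝ 1 N) (hNν : ∀ p ∈ frontier Ω, IsOuterUnitNormal Ω p (N p))
    (hp : p ∈ frontier Ω) (hτ0 : τ ≠ 0) (hτ : ⟪N p, τ⟫ = 0) : 0 < ⟪fderiv ℝ N p τ, τ⟫ := by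
  obtain ⟨ρ, hρ, hconv⟩ := hΩ.boundary p hp
  have hρτ : fderiv ℝ ρ p τ = 0 := by
    rw [(hNν p hp).unique (hρ.of_le (by lia)).isOuterUnitNormal, real_inner_smul_left,
      inner_gradient_left] at hτ
    exact (mul_eq_zero.1 hτ).resolve_left (inv_ne_zero (norm_ne_zero_iff.2 hρ.gradient_ne_zero))
  have hpos := hconv τ hτ0 hρτ
  rw [snd_fderiv_eq_mul_inner_fderiv_normal hΩ.isOpen hN hNν hp (hρ.of_le hm) hτ] at hpos
  exact pos_of_mul_pos_right hpos (norm_nonneg _)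

theorem IsStrictlyConvexDomain.exists_curvature_bound (hΩ : IsStrictlyConvexDomain m Ω)
    (hm : 2 ≤ m) (hN : ContDiff ℝ 1 N) (hNν : ∀ p ∈ frontier Ω, IsOuterUnitNormal Ω p (N p)) :
    ∃ κ : ℝ, 0 < κ ∧ ∀ p ∈ frontier Ω, ∀ τ : E n, ⟪N p, τ⟫ = 0 →
      κ * ‖τ‖ ^ 2 ≤ ⟪fderiv ℝ N p τ, τ⟫ := by
  have hNc : Continuous N := hN.continuous
  have hN' : Continuous (fderiv ℝ N) := hN.continuous_fderiv one_ne_zero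
  have hcompact : IsCompact (frontier Ω) :=
    Metric.isCompact_of_isClosed_isBounded isClosed_frontier
      (hΩ.isBounded.closure.subset frontier_subset_closure)
  set S : Set (E n × E n) := (frontier Ω ×ˢ Metric.sphere 0 1) ∩ {z | ⟪N z.1, z.2⟫ = 0}
  have hS : IsCompact S := (hcompact.prod (isCompact_sphere 0 1)).inter_right
    (isClosed_eq (by fun_prop) continuous_const)
  obtain ⟨κ, hκ, hmin⟩ := hS.exists_forall_le' (a := 0)
    (f := fun z : E n × E n => ⟪fderiv ℝ N z.1 z.2, z.2⟫) (by fun_prop) (by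
      rintro ⟨p, τ⟩ ⟨⟨hp, hτ⟩, hpτ⟩
      exact hΩ.inner_fderiv_normal_pos hm hN hNν hp (ne_zero_of_mem_unit_sphere ⟨τ, hτ⟩) hpτ)
  refine ⟨κ, hκ, fun p hp τ hτ => ?_⟩
  rcases eq_or_ne τ 0 with rfl | hτ0
  · simp
  have hle := hmin (p, ‖τ‖⁻¹ • τ) ⟨⟨hp, by simp [norm_smul, hτ0]⟩, by
    simp [real_inner_smul_right, hτ]⟩
  simp only [map_smul, real_inner_smul_left, real_inner_smul_right] at hle
  calc κ * ‖τ‖ ^ 2 ≤ (‖τ‖⁻¹ * (‖τ‖⁻¹ * ⟪fderiv ℝ N p τ, τ⟫)) * ‖τ‖ ^ 2 := by gcongr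
    _ = ⟪fderiv ℝ N p τ, τ⟫ := by field_simp

namespace IsStrictlyConvexDomain

theorem isCompact_closure (hΩ : IsStrictlyConvexDomain m Ω) : IsCompact (closure Ω) :=
  Metric.isCompact_of_isClosed_isBounded isClosed_closure hΩ.isBounded.closure

theorem closure_mem_nhds (hΩ : IsStrictlyConvexDomain m Ω) {x : E n} (hx : x ∈ Ω) :
    closure Ω ∈ 𝓝 x :=
  Filter.mem_of_superset (hΩ.isOpen.mem_nhds hx) subset_closure

theorem mem_or_mem_frontier (hΩ : IsStrictlyConvexDomain m Ω) {x : E n} (hx : x ∈ closure Ω) :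
    x ∈ Ω ∨ x ∈ frontier Ω := by
  rwa [← Set.mem_union, hΩ.isOpen.frontier_eq, Set.union_sdiff_cancel subset_closure]

theorem uniqueDiffOn (hΩ : IsStrictlyConvexDomain m Ω) : UniqueDiffOn ℝ (closure Ω) :=
  uniqueDiffOn_convex hΩ.convex.closure
    (hΩ.nonempty.mono (interior_maximal subset_closure hΩ.isOpen))

end IsStrictlyConvexDomain

/-- `N` is a `C²` extension of the outer unit normal of `Ω`; moreover `Ω̄` lies in the ball of
radius `R` about `0`, the principal curvatures of `∂Ω` are at least `κ`, and `c` bounds `N` and its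
first two derivatives on `Ω̄`. -/
structure IsNormalField (Ω : Set (E n)) (N : E n → E n) (R κ c : ℝ) : Prop where
  contDiff : ContDiff ℝ 2 N
  isOuterUnitNormal : ∀ p ∈ frontier Ω, IsOuterUnitNormal Ω p (N p)
  norm_le : ∀ x ∈ closure Ω, ‖x‖ ≤ R
  curvature_pos : 0 < κ
  curvature_le : ∀ p ∈ frontier Ω, ∀ τ : E n, ⟪N p, τ⟫ = 0 → κ * ‖τ‖ ^ 2 ≤ ⟪fderiv ℝ N p τ, τ⟫
  norm_apply_le : ∀ x ∈ closure Ω, ‖N x‖ ≤ c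
  norm_fderiv_le : ∀ x ∈ closure Ω, ‖fderiv ℝ N x‖ ≤ c
  norm_snd_fderiv_le : ∀ x ∈ closure Ω, ‖fderiv ℝ (fderiv ℝ N) x‖ ≤ c

theorem IsStrictlyConvexDomain.exists_isNormalField (hΩ : IsStrictlyConvexDomain 3 Ω) :
    ∃ N R κ c, IsNormalField Ω N R κ c := by
  obtain ⟨N, hN, hNν⟩ := exists_contDiff_forall_isOuterUnitNormal (m := 2) hΩ.isOpen
    fun p hp => (hΩ.boundary p hp).imp fun _ => And.left
  obtain ⟨κ, hκ, hκN⟩ := hΩ.exists_curvature_bound (by norm_num) (hN.of_le one_le_two) hNν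
  have hN' : ContDiff ℝ 1 (fderiv ℝ N) := hN.fderiv_right le_rfl
  have hcompact := hΩ.isCompact_closure
  obtain ⟨R, hR⟩ := hcompact.exists_bound_of_continuousOn continuousOn_id
  obtain ⟨c₀, hc₀⟩ := hcompact.exists_bound_of_continuousOn hN.continuous.continuousOn
  obtain ⟨c₁, hc₁⟩ := hcompact.exists_bound_of_continuousOn hN'.continuous.continuousOn
  obtain ⟨c₂, hc₂⟩ := hcompact.exists_bound_of_continuousOn
    (hN'.continuous_fderiv one_ne_zero).continuousOn
  exact ⟨N, R, κ, max c₀ (max c₁ c₂), hN, hNν, hR, hκ, hκN,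
    fun x hx => (hc₀ x hx).trans (le_max_left _ _),
    fun x hx => (hc₁ x hx).trans ((le_max_left _ _).trans (le_max_right _ _)),
    fun x hx => (hc₂ x hx).trans ((le_max_right _ _).trans (le_max_right _ _))⟩

end Normal

/-! ### The gradient bound at the boundary -/

section Boundary

variable {n : ℕ} {Ω : Set (E n)} {N : E n → E n} {N' : E n →L[ℝ] E n} {u b : E n → ℝ}
  {b' : E n →L[ℝ] ℝ} {p τ : E n} {K R κ c B b₀ : ℝ}

/-- The vector field `Du - bN` on `Ω̄`: when `N` is the outer unit normal and `u_ν = b` on `∂Ω`, its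
values on `∂Ω` are the tangential parts of the gradient of `u`. -/
def tangentialGradient (Ω : Set (E n)) (N : E n → E n) (b u : E n → ℝ) (y : E n) : E n :=
  gradientWithin u (closure Ω) y - b y • N y

/-- The function to which the maximum principle is applied; the quadratic term makes it a strict
subsolution of the linearized equation when `K` is large. -/
def auxiliaryFunction (Ω : Set (E n)) (N : E n → E n) (b u : E n → ℝ) (K : ℝ) (y : E n) : ℝ :=
  ‖tangentialGradient Ω N b u y‖ ^ 2 + K / 2 * ‖y‖ ^ 2

theorem fderivWithin_apply_eq_inner_tangentialGradient_add (y v : E n) :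
    fderivWithin ℝ u (closure Ω) y v = ⟪tangentialGradient Ω N b u y, v⟫ + b y * ⟪N y, v⟫ := by
  rw [tangentialGradient, inner_sub_left, inner_gradientWithin_left, real_inner_smul_left,
    sub_add_cancel]

theorem inner_normal_tangentialGradient (hν : IsOuterUnitNormal Ω p (N p))
    (hbc : fderivWithin ℝ u (closure Ω) p (N p) = b p) :
    ⟪N p, tangentialGradient Ω N b u p⟫ = 0 := by
  rw [fderivWithin_apply_eq_inner_tangentialGradient_add (N := N) (b := b),
    real_inner_self_eq_norm_sq, hν.norm_eq_one] at hbc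
  rw [real_inner_comm]
  linarith

theorem tangential_fderiv_boundary_condition (hν : IsOuterUnitNormal Ω p (N p))
    (hp : p ∈ frontier Ω) {D : E n → E n →L[ℝ] ℝ} {H : E n →L[ℝ] E n →L[ℝ] ℝ}
    (hD : HasFDerivWithinAt D H (closure Ω) p) (hN : HasFDerivWithinAt N N' (closure Ω) p)
    (hb : HasFDerivWithinAt b b' (closure Ω) p) (hbc : ∀ q ∈ frontier Ω, D q (N q) = b q)
    (hτ : ⟪N p, τ⟫ = 0) : D p (N' τ) + H τ (N p) = b' τ := by
  have hzero := hν.apply_eq_zero_of_eventuallyEq hp hτ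
    (((hD.clm_apply hN).fun_sub hb).mono frontier_subset_closure) (by
      filter_upwards [self_mem_nhdsWithin] with q hq
      rw [hbc q hq, sub_self])
  simpa [sub_eq_zero] using hzero

theorem normal_fderiv_nonneg_of_isMaxOn (hν : IsOuterUnitNormal Ω p (N p))
    (hΩ : Convex ℝ Ω) (hp : p ∈ frontier Ω) {H : E n →L[ℝ] E n →L[ℝ] ℝ}
    (hD : HasFDerivWithinAt (fderivWithin ℝ u (closure Ω)) H (closure Ω) p)
    (hN : HasFDerivWithinAt N N' (closure Ω) p) (hb : HasFDerivWithinAt b b' (closure Ω) p)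
    (hbc : fderivWithin ℝ u (closure Ω) p (N p) = b p)
    (hmax : IsMaxOn (auxiliaryFunction Ω N b u K) (closure Ω) p) :
    0 ≤ 2 * (H (N p) (tangentialGradient Ω N b u p)
      - b p * ⟪tangentialGradient Ω N b u p, N' (N p)⟫) + K * ⟪p, N p⟫ := by
  have hV : HasFDerivWithinAt (tangentialGradient Ω N b u)
      (riesz.comp H - (b p • N' + b'.smulRight (N p))) (closure Ω) p :=
    ((riesz (V := E n)).hasFDerivAt.comp_hasFDerivWithinAt p hD).fun_sub (hb.fun_smul hN)
  have hle := hν.apply_nonneg_of_isMaxOn hΩ hp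
    (hV.norm_sq.fun_add ((hasFDerivWithinAt_id p (closure Ω)).norm_sq.const_mul (K / 2))) hmax
  have hort := inner_normal_tangentialGradient hν hbc
  rw [real_inner_comm] at hort
  have hriesz : ⟪tangentialGradient Ω N b u p, riesz (H (N p))⟫
      = H (N p) (tangentialGradient Ω N b u p) := by
    rw [real_inner_comm, inner_riesz]
  refine hle.trans_eq ?_
  simp [hort, hriesz]
  ring

/-- Exchanging the order of the two derivatives in `D²u(ν, τ)` turns the normal derivative of
`|τ|²` into the tangential derivative of `u_ν = b`, up to curvature terms of favourable sign. -/
theorem IsStrictlyConvexDomain.boundary_inequality_of_isMaxOn (hΩ : IsStrictlyConvexDomain 3 Ω)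
    (hN : IsNormalField Ω N R κ c) (hu : ContDiffOn ℝ 2 u (closure Ω))
    (hbc : ∀ q ∈ frontier Ω, fderivWithin ℝ u (closure Ω) q (N q) = b q) (hp : p ∈ frontier Ω)
    (hb : HasFDerivWithinAt b b' (closure Ω) p)
    (hmax : IsMaxOn (auxiliaryFunction Ω N b u K) (closure Ω) p) {τ : E n}
    (hτ : τ = tangentialGradient Ω N b u p) :
    2 * ⟪fderiv ℝ N p τ, τ⟫ ≤ 2 * (b' τ - b p * ⟪N p, fderiv ℝ N p τ⟫
      - b p * ⟪τ, fderiv ℝ N p (N p)⟫) + K * ⟪p, N p⟫ := by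
  have hpc : p ∈ closure Ω := hp.1
  have hν := hN.isOuterUnitNormal p hp
  have hNd : HasFDerivWithinAt N (fderiv ℝ N p) (closure Ω) p :=
    (hN.contDiff.differentiable two_ne_zero p).hasFDerivAt.hasFDerivWithinAt
  set D := fderivWithin ℝ u (closure Ω)
  have hD : HasFDerivWithinAt D (fderivWithin ℝ D (closure Ω) p) (closure Ω) p :=
    ((hu.fderivWithin hΩ.uniqueDiffOn (m := 1) le_rfl).differentiableOn one_ne_zero
      p hpc).hasFDerivWithinAt
  have hsymm : fderivWithin ℝ D (closure Ω) p (N p) τ = fderivWithin ℝ D (closure Ω) p τ (N p) :=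
    (hu p hpc).isSymmSndFDerivWithinAt (by simp) hΩ.uniqueDiffOn
      (closure_mono (interior_maximal subset_closure hΩ.isOpen) hpc) hpc _ _
  have hort : ⟪N p, τ⟫ = 0 := hτ ▸ inner_normal_tangentialGradient hν (hbc p hp)
  have htangential := tangential_fderiv_boundary_condition hν hp hD hNd hb hbc hort
  have hnormal := normal_fderiv_nonneg_of_isMaxOn hν hΩ.convex hp hD hNd hb (hbc p hp) hmax
  rw [← hτ, hsymm] at hnormal
  rw [fderivWithin_apply_eq_inner_tangentialGradient_add (N := N) (b := b), ← hτ,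
    real_inner_comm] at htangential
  linarith

theorem sq_le_of_mul_sq_le {t G S : ℝ} (hκ : 0 < κ) (h : 2 * κ * t ^ 2 ≤ 2 * G * t + S) :
    t ^ 2 ≤ G ^ 2 / κ ^ 2 + S / κ := by
  have hsq : 0 ≤ (κ * t - G) ^ 2 := sq_nonneg _
  rw [div_add_div _ _ (by positivity) hκ.ne', le_div_iff₀ (by positivity)]
  nlinarith [mul_le_mul_of_nonneg_left h (mul_pos hκ hκ).le]

theorem IsStrictlyConvexDomain.norm_sq_tangentialGradient_le_of_isMaxOn
    (hΩ : IsStrictlyConvexDomain 3 Ω) (hN : IsNormalField Ω N R κ c)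
    (hu : ContDiffOn ℝ 2 u (closure Ω))
    (hbc : ∀ q ∈ frontier Ω, fderivWithin ℝ u (closure Ω) q (N q) = b q) (hp : p ∈ frontier Ω)
    (hb : HasFDerivWithinAt b b' (closure Ω) p) (hK : 0 ≤ K)
    (hmax : IsMaxOn (auxiliaryFunction Ω N b u K) (closure Ω) p) {τ : E n}
    (hτ : τ = tangentialGradient Ω N b u p)
    (hb₀ : |b p| ≤ b₀) (hb' : b' τ ≤ B * ‖τ‖) :
    ‖τ‖ ^ 2 ≤ (B + 2 * b₀ * c) ^ 2 / κ ^ 2 + K * R / κ := by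
  have hν := hN.isOuterUnitNormal p hp
  have hN' : ∀ v, ‖fderiv ℝ N p v‖ ≤ c * ‖v‖ :=
    fun v => (fderiv ℝ N p).le_of_opNorm_le (hN.norm_fderiv_le p hp.1) v
  have hbterm : ∀ v w : E n, ‖v‖ * ‖w‖ ≤ c * ‖τ‖ → -(b p * ⟪v, w⟫) ≤ b₀ * (c * ‖τ‖) := by
    intro v w hvw
    calc -(b p * ⟪v, w⟫) ≤ |b p| * |⟪v, w⟫| := abs_mul (b p) _ ▸ neg_le_abs _
      _ ≤ b₀ * (c * ‖τ‖) := by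
        gcongr
        · exact (abs_nonneg _).trans hb₀
        · exact (abs_real_inner_le_norm v w).trans hvw
  have hmixed := hbterm (N p) (fderiv ℝ N p τ) (by simpa [hν.norm_eq_one] using hN' τ)
  have hnormal := hbterm τ (fderiv ℝ N p (N p)) (by
    simpa [hν.norm_eq_one, mul_comm] using
      mul_le_mul_of_nonneg_left (hN' (N p)) (norm_nonneg τ))
  have hradial : K * ⟪p, N p⟫ ≤ K * R := by
    gcongr
    calc ⟪p, N p⟫ ≤ ‖p‖ * ‖N p‖ := real_inner_le_norm _ _
      _ = ‖p‖ := by rw [hν.norm_eq_one, mul_one]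
      _ ≤ R := hN.norm_le p hp.1
  have hort : ⟪N p, τ⟫ = 0 := hτ ▸ inner_normal_tangentialGradient hν (hbc p hp)
  have hcurv := hN.curvature_le p hp τ hort
  refine sq_le_of_mul_sq_le hN.curvature_pos ?_
  linarith [hΩ.boundary_inequality_of_isMaxOn hN hu hbc hp hb hmax hτ]

end Boundary

/-! ### The maximum principle in the interior -/

theorem abs_sum_mul_le {ι : Type*} [Fintype ι] {w f : ι → ℝ} {B : ℝ} (hw : ∀ i, 0 ≤ w i)
    (hw1 : ∑ i, w i = 1) (hf : ∀ i, |f i| ≤ B) : |∑ i, w i * f i| ≤ B := by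
  simpa using (convex_closedBall (0 : ℝ) B).sum_mem (fun i _ => hw i) hw1
    (fun i _ => by simpa using hf i)

section BoundaryDatum

variable {V : Type*} [NormedAddCommGroup V] [NormedSpace ℝ V] {u Φ : V → ℝ} {x : V}
  {ε M B C : ℝ}

theorem IsLinearizedFrame.abs_sum_snd_fderiv_sub_smul_le {ι : Type*} [Fintype ι]
    {e : ι → V} {w : ι → ℝ} (h : IsLinearizedFrame u x C e w)
    (hu : ContDiffAt ℝ 2 u x) (hΦ : ContDiffAt ℝ 2 Φ x) (hε : 0 ≤ ε)
    (hB : ‖fderiv ℝ (fderiv ℝ Φ) x‖ ≤ B) :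
    |∑ i, w i * fderiv ℝ (fderiv ℝ fun y => Φ y - ε * u y) x (e i) (e i)| ≤ B + ε * C := by
  have hsnd : ∀ v, fderiv ℝ (fderiv ℝ fun y => Φ y - ε * u y) x v v
      = fderiv ℝ (fderiv ℝ Φ) x v v - ε * fderiv ℝ (fderiv ℝ u) x v v := fun v =>
    (hasSndDerivAt_comp_line (hΦ.sub (contDiffAt_const.mul hu)) v).unique_snd
      ((hasSndDerivAt_comp_line hΦ v).sub ((hasSndDerivAt_comp_line hu v).const_smul ε))
  have hΦ' : ∀ i, |fderiv ℝ (fderiv ℝ Φ) x (e i) (e i)| ≤ B := fun i => by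
    simpa using (fderiv ℝ (fderiv ℝ Φ) x).le_of_opNorm₂_le_of_le hB (h.norm_eq_one i).le
      (h.norm_eq_one i).le
  have hsum : ∑ i, w i * fderiv ℝ (fderiv ℝ fun y => Φ y - ε * u y) x (e i) (e i)
      = ∑ i, w i * fderiv ℝ (fderiv ℝ Φ) x (e i) (e i)
        - ε * ∑ i, w i * fderiv ℝ (fderiv ℝ u) x (e i) (e i) := by
    rw [Finset.mul_sum, ← Finset.sum_sub_distrib]
    exact Finset.sum_congr rfl fun i _ => by rw [hsnd]; ring
  rw [hsum]
  refine (abs_sub _ _).trans (add_le_add (abs_sum_mul_le h.nonneg h.sum_eq_one hΦ') ?_)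
  rw [abs_mul, abs_of_nonneg hε]
  exact mul_le_mul_of_nonneg_left h.abs_snd_le hε

theorem norm_fderiv_sub_smul_le (hu : DifferentiableAt ℝ u x) (hΦ : DifferentiableAt ℝ Φ x)
    (hε : 0 ≤ ε) (hB : ‖fderiv ℝ Φ x‖ ≤ B) (hM : ‖fderiv ℝ u x‖ ≤ M) :
    ‖fderiv ℝ (fun y => Φ y - ε * u y) x‖ ≤ B + ε * M := by
  rw [(hΦ.hasFDerivAt.fun_sub (hu.hasFDerivAt.const_mul ε)).fderiv]
  refine (norm_sub_le _ _).trans (add_le_add hB ?_)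
  rw [norm_smul, Real.norm_of_nonneg hε]
  gcongr

end BoundaryDatum

section Interior

variable {V : Type*} [NormedAddCommGroup V] [InnerProductSpace ℝ V] {u b : V → ℝ} {N : V → V}
  {x W : V} {K C c b₀ b₁ b₂ : ℝ}

/-- Minus half the part of the second derivative of `|Du - bN|²` along `e` which comes from `bN`. -/
def normalTerm (b : V → ℝ) (N : V → V) (x W e : V) : ℝ :=
  fderiv ℝ (fderiv ℝ b) x e e * ⟪W, N x⟫ + 2 * fderiv ℝ b x e * ⟪W, fderiv ℝ N x e⟫
    + b x * ⟪W, fderiv ℝ (fderiv ℝ N) x e e⟫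

theorem third_fderiv_sub_normalTerm_le_of_isLocalMax [CompleteSpace V]
    (hu : ContDiffAt ℝ 3 u x)
    (hb : ContDiffAt ℝ 2 b x) (hN : ContDiffAt ℝ 2 N x)
    (hmax : IsLocalMax (fun y => ‖gradient u y - b y • N y‖ ^ 2 + K / 2 * ‖y‖ ^ 2) x)
    (hW : W = gradient u x - b x • N x) (e : V) :
    2 * (fderiv ℝ (fderiv ℝ (fderiv ℝ u)) x W e e - normalTerm b N x W e) + K * ‖e‖ ^ 2 ≤ 0 := by
  have hDu : HasSndDerivAt (fun s : ℝ => gradient u (x + s • e)) _ _ 0 :=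
    (hasSndDerivAt_comp_line (hu.fderiv_right (m := 2) (by norm_num)) e).clm_comp riesz
  have hbN := (hasSndDerivAt_comp_line hb e).smul (hasSndDerivAt_comp_line hN e)
  have hsnd := ((hDu.sub hbN).norm_sq.add
    ((hasSndDerivAt_line x e 0).norm_sq.const_smul (K / 2))).nonpos_of_isLocalMax
      (isLocalMax_comp_line hmax e)
  simp only [zero_smul, add_zero, ← hW, smul_eq_mul, inner_zero_right] at hsnd
  rw [inner_sub_right, inner_add_right, inner_add_right, real_inner_smul_right,
    real_inner_smul_right, real_inner_smul_right, real_inner_comm, inner_riesz,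
    third_fderiv_symm hu] at hsnd
  rw [normalTerm]
  nlinarith

variable {ι : Type*} [Fintype ι] {e : ι → V} {w : ι → ℝ}

theorem abs_sum_mul_normalTerm_le (he : ∀ i, ‖e i‖ = 1) (hw : ∀ i, 0 ≤ w i) (hw1 : ∑ i, w i = 1)
    (hb₀ : |b x| ≤ b₀) (hb₁ : ‖fderiv ℝ b x‖ ≤ b₁)
    (hb₂ : |∑ i, w i * fderiv ℝ (fderiv ℝ b) x (e i) (e i)| ≤ b₂)
    (hc₀ : ‖N x‖ ≤ c) (hc₁ : ‖fderiv ℝ N x‖ ≤ c) (hc₂ : ‖fderiv ℝ (fderiv ℝ N) x‖ ≤ c) :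
    |∑ i, w i * normalTerm b N x W (e i)| ≤ ‖W‖ * ((b₂ + 2 * b₁ + b₀) * c) := by
  have hinner : ∀ {v : V}, ‖v‖ ≤ c → |⟪W, v⟫| ≤ ‖W‖ * c := fun {v} hv =>
    (abs_real_inner_le_norm W v).trans (by gcongr)
  have hb₁0 : 0 ≤ b₁ := (norm_nonneg _).trans hb₁
  have hrest : ∀ i, |2 * fderiv ℝ b x (e i) * ⟪W, fderiv ℝ N x (e i)⟫
      + b x * ⟪W, fderiv ℝ (fderiv ℝ N) x (e i) (e i)⟫| ≤ (2 * b₁ + b₀) * (‖W‖ * c) := fun i => by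
    have hDb : |fderiv ℝ b x (e i)| ≤ b₁ := by
      simpa [he i] using (fderiv ℝ b x).le_of_opNorm_le hb₁ (e i)
    have hDN := hinner (by simpa [he i] using (fderiv ℝ N x).le_of_opNorm_le hc₁ (e i))
    have hD2N := hinner (by
      simpa using (fderiv ℝ (fderiv ℝ N) x).le_of_opNorm₂_le_of_le hc₂ (he i).le (he i).le)
    refine (abs_add_le _ _).trans ?_
    rw [abs_mul, abs_mul, abs_mul, abs_two, add_mul]
    gcongr
    exact (abs_nonneg _).trans hb₀
  have hsum : ∑ i, w i * normalTerm b N x W (e i)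
      = (∑ i, w i * fderiv ℝ (fderiv ℝ b) x (e i) (e i)) * ⟪W, N x⟫
        + ∑ i, w i * (2 * fderiv ℝ b x (e i) * ⟪W, fderiv ℝ N x (e i)⟫
          + b x * ⟪W, fderiv ℝ (fderiv ℝ N) x (e i) (e i)⟫) := by
    rw [Finset.sum_mul, ← Finset.sum_add_distrib]
    exact Finset.sum_congr rfl fun i _ => by rw [normalTerm]; ring
  rw [hsum, show ‖W‖ * ((b₂ + 2 * b₁ + b₀) * c)
    = b₂ * (‖W‖ * c) + (2 * b₁ + b₀) * (‖W‖ * c) by ring]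
  refine (abs_add_le _ _).trans (add_le_add ?_ (abs_sum_mul_le hw hw1 hrest))
  rw [abs_mul]
  exact mul_le_mul hb₂ (hinner hc₀) (abs_nonneg _) ((abs_nonneg _).trans hb₂)

theorem IsLinearizedFrame.le_of_isLocalMax [CompleteSpace V] (h : IsLinearizedFrame u x C e w)
    (hu : ContDiffAt ℝ 3 u x) (hb : ContDiffAt ℝ 2 b x) (hN : ContDiffAt ℝ 2 N x)
    (hmax : IsLocalMax (fun y => ‖gradient u y - b y • N y‖ ^ 2 + K / 2 * ‖y‖ ^ 2) x)
    (hW : W = gradient u x - b x • N x)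
    (hb₀ : |b x| ≤ b₀) (hb₁ : ‖fderiv ℝ b x‖ ≤ b₁)
    (hb₂ : |∑ i, w i * fderiv ℝ (fderiv ℝ b) x (e i) (e i)| ≤ b₂)
    (hc₀ : ‖N x‖ ≤ c) (hc₁ : ‖fderiv ℝ N x‖ ≤ c) (hc₂ : ‖fderiv ℝ (fderiv ℝ N) x‖ ≤ c) :
    K ≤ 2 * ‖W‖ * (C + (b₂ + 2 * b₁ + b₀) * c) := by
  have hsum : ∑ i, w i * (2 * (fderiv ℝ (fderiv ℝ (fderiv ℝ u)) x W (e i) (e i)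
      - normalTerm b N x W (e i)) + K) ≤ 0 := Finset.sum_nonpos fun i _ =>
    mul_nonpos_of_nonneg_of_nonpos (h.nonneg i) (by
      simpa [h.norm_eq_one i] using
        third_fderiv_sub_normalTerm_le_of_isLocalMax hu hb hN hmax hW (e i))
  have hsplit : ∑ i, w i * (2 * (fderiv ℝ (fderiv ℝ (fderiv ℝ u)) x W (e i) (e i)
      - normalTerm b N x W (e i)) + K)
      = 2 * (∑ i, w i * fderiv ℝ (fderiv ℝ (fderiv ℝ u)) x W (e i) (e i)
        - ∑ i, w i * normalTerm b N x W (e i)) + (∑ i, w i) * K := by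
    rw [← Finset.sum_sub_distrib, Finset.mul_sum, Finset.sum_mul, ← Finset.sum_add_distrib]
    exact Finset.sum_congr rfl fun i _ => by ring
  rw [hsplit, h.sum_eq_one, one_mul] at hsum
  have hthird := neg_le_of_abs_le (h.abs_third_le W)
  have hnormal := le_of_abs_le (abs_sum_mul_normalTerm_le (W := W) h.norm_eq_one h.nonneg
    h.sum_eq_one hb₀ hb₁ hb₂ hc₀ hc₁ hc₂)
  linarith

end Interior

/-! ### The bound of `ε|u|` -/

section ZerothOrder

variable {n k : ℕ} {Ω : Set (E n)} {α : Fin k → E n → ℝ} {φ u : E n → ℝ} {N : E n → E n}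
  {p x : E n} {ε A B R κ c β : ℝ}

namespace IsApproxSolution

theorem exists_isDiagonalSolution (h : IsApproxSolution k Ω α φ ε u) (hΩ : IsOpen Ω)
    (hp : p ∈ Ω) : ∃ (e : Fin n → E n) (lam : Fin n → ℝ), (∀ i, ‖e i‖ = 1) ∧
      (∀ i, fderiv ℝ (fderiv ℝ u) p (e i) (e i) = lam i) ∧
      IsDiagonalSolution (fun l => α l p) lam := by
  obtain ⟨e, lam, hdiag, hlam⟩ := exists_eigenbasis hp
    ((h.contDiffOn.contDiffAt (hΩ.mem_nhds hp)).of_le (by norm_num)) h.admissible h.equation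
  exact ⟨e, lam, e.orthonormal.1,
    fun i => by simpa [formMatrix] using congrFun (congrFun hdiag i) i, hlam⟩

theorem hasSndDerivAt_line (h : IsApproxSolution k Ω α φ ε u) (hΩ : IsOpen Ω) (hp : p ∈ Ω)
    (v : E n) : HasSndDerivAt (fun s : ℝ => u (p + s • v)) (fderiv ℝ u p v)
      (fderiv ℝ (fderiv ℝ u) p v v) 0 :=
  hasSndDerivAt_comp_line ((h.contDiffOn.contDiffAt (hΩ.mem_nhds hp)).of_le (by norm_num)) v

theorem not_isLocalMax (h : IsApproxSolution k Ω α φ ε u) (hΩ : IsOpen Ω) (hp : p ∈ Ω) :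
    ¬ IsLocalMax u p := fun hmax => by
  obtain ⟨e, lam, -, hsnd, hlam⟩ := h.exists_isDiagonalSolution hΩ hp
  obtain ⟨i, hi⟩ := hlam.exists_pos
  have hle := (h.hasSndDerivAt_line hΩ hp (e i)).nonpos_of_isLocalMax
    (isLocalMax_comp_line hmax (e i))
  exact hle.not_gt (hsnd i ▸ hi)

theorem not_isLocalMax_sub (h : IsApproxSolution k Ω α φ ε u) (hΩ : IsOpen Ω) (hp : p ∈ Ω)
    (hα : ∀ l, 0 ≤ α l p) (hαA : ∀ l, α l p ≤ A) (hβ : k * (1 + k * A) < β) :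
    ¬ IsLocalMax (fun y => β / 2 * ‖y‖ ^ 2 - u y) p := fun hmax => by
  obtain ⟨e, lam, he, hsnd, hlam⟩ := h.exists_isDiagonalSolution hΩ hp
  obtain ⟨i, hi⟩ := hlam.exists_lt hα hαA hβ
  have hle := (((MixedHessian.hasSndDerivAt_line p (e i) 0).norm_sq.const_smul (β / 2)).sub
    (h.hasSndDerivAt_line hΩ hp (e i))).nonpos_of_isLocalMax (isLocalMax_comp_line hmax (e i))
  simp only [he i, hsnd i, inner_zero_right, smul_eq_mul] at hle
  linarith

theorem hasFDerivWithinAt (h : IsApproxSolution k Ω α φ ε u) (hx : x ∈ closure Ω) :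
    HasFDerivWithinAt u (fderivWithin ℝ u (closure Ω) x) (closure Ω) x :=
  (h.contDiffOn_closure.differentiableOn two_ne_zero x hx).hasFDerivWithinAt

theorem eps_mul_le (h : IsApproxSolution k Ω α φ ε u) (hΩ : IsStrictlyConvexDomain 3 Ω)
    (hN : IsNormalField Ω N R κ c) (hε : 0 ≤ ε) (hφ : ∀ p ∈ frontier Ω, |φ p| ≤ B)
    (hx : x ∈ closure Ω) : ε * u x ≤ B := by
  obtain ⟨p, hp, hmax⟩ := hΩ.isCompact_closure.exists_isMaxOn ⟨x, hx⟩
    h.contDiffOn_closure.continuousOn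
  rcases hΩ.mem_or_mem_frontier hp with hpΩ | hpf
  · exact absurd (hmax.isLocalMax (hΩ.closure_mem_nhds hpΩ)) (h.not_isLocalMax hΩ.isOpen hpΩ)
  have hν := hN.isOuterUnitNormal p hpf
  have hnormal := hν.apply_nonneg_of_isMaxOn hΩ.convex hpf (h.hasFDerivWithinAt hp) hmax
  rw [h.neumann p hpf _ hν] at hnormal
  calc ε * u x ≤ ε * u p := by gcongr; exact hmax hx
    _ ≤ φ p := by linarith
    _ ≤ B := le_of_abs_le (hφ p hpf)

end IsApproxSolution

/-- The constant in the lower bound of `εu`. -/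
def supConst (k : ℕ) (A B R : ℝ) : ℝ := B + (k * (1 + k * A) + 1) * (R + R ^ 2)

theorem IsApproxSolution.neg_le_eps_mul (h : IsApproxSolution k Ω α φ ε u)
    (hΩ : IsStrictlyConvexDomain 3 Ω) (hN : IsNormalField Ω N R κ c) (hε : 0 ≤ ε) (hε1 : ε ≤ 1)
    (hφ : ∀ p ∈ frontier Ω, |φ p| ≤ B) (hα : ∀ x ∈ Ω, ∀ l, 0 ≤ α l x)
    (hαA : ∀ x ∈ Ω, ∀ l, α l x ≤ A) (hA : 0 ≤ A) (hx : x ∈ closure Ω) :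
    -supConst k A B R ≤ ε * u x := by
  set β : ℝ := k * (1 + k * A) + 1 with hβ
  have hβ0 : 0 ≤ β := by positivity
  obtain ⟨p, hp, hmax⟩ := hΩ.isCompact_closure.exists_isMaxOn ⟨x, hx⟩
    (f := fun y => β / 2 * ‖y‖ ^ 2 - u y)
    (ContinuousOn.sub (by fun_prop) h.contDiffOn_closure.continuousOn)
  rcases hΩ.mem_or_mem_frontier hp with hpΩ | hpf
  · exact absurd (hmax.isLocalMax (hΩ.closure_mem_nhds hpΩ))
      (h.not_isLocalMax_sub hΩ.isOpen hpΩ (hα p hpΩ) (hαA p hpΩ) (lt_add_one _))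
  have hν := hN.isOuterUnitNormal p hpf
  have hnormal := hν.apply_nonneg_of_isMaxOn hΩ.convex hpf
    (((hasFDerivWithinAt_id p (closure Ω)).norm_sq.const_mul (β / 2)).fun_sub
      (h.hasFDerivWithinAt hp)) hmax
  have hradial : ⟪p, N p⟫ ≤ R :=
    calc ⟪p, N p⟫ ≤ ‖p‖ * ‖N p‖ := real_inner_le_norm _ _
      _ = ‖p‖ := by rw [hν.norm_eq_one, mul_one]
      _ ≤ R := hN.norm_le p hp
  have hp_le : -B - β * R ≤ ε * u p := by
    have hle : 0 ≤ β * ⟪p, N p⟫ - fderivWithin ℝ u (closure Ω) p (N p) := by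
      refine hnormal.trans_eq ?_
      simp
      ring
    rw [h.neumann p hpf _ hν] at hle
    have hβR : β * ⟪p, N p⟫ ≤ β * R := by gcongr
    linarith [neg_le_of_abs_le (hφ p hpf)]
  have hx_le : u p - β / 2 * R ^ 2 ≤ u x := by
    have hle : β / 2 * ‖x‖ ^ 2 - u x ≤ β / 2 * ‖p‖ ^ 2 - u p := hmax hx
    have hβp : β / 2 * ‖p‖ ^ 2 ≤ β / 2 * R ^ 2 := by gcongr; exact hN.norm_le p hp
    have hβx : 0 ≤ β / 2 * ‖x‖ ^ 2 := by positivity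
    linarith
  have hεR : ε * (β / 2 * R ^ 2) ≤ β * R ^ 2 :=
    (mul_le_of_le_one_left (by positivity) hε1).trans (by nlinarith [sq_nonneg R])
  rw [supConst, ← hβ]
  linarith [mul_le_mul_of_nonneg_left hx_le hε]

end ZerothOrder

/-! ### The gradient bound -/

section GradientBound

variable {n k : ℕ} {Ω : Set (E n)} {α : Fin k → E n → ℝ} {Φ u : E n → ℝ} {N : E n → E n}
  {p x : E n} {ε a A B R κ c b₀ M K : ℝ}

theorem IsNormalField.norm_smul_apply_le {t : ℝ} (hN : IsNormalField Ω N R κ c)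
    (hx : x ∈ closure Ω) (ht : |t| ≤ b₀) : ‖t • N x‖ ≤ b₀ * c := by
  rw [norm_smul]
  exact mul_le_mul ht (hN.norm_apply_le x hx) (norm_nonneg _) ((abs_nonneg t).trans ht)

theorem IsStrictlyConvexDomain.isLocalMax_of_isMaxOn_auxiliaryFunction {b : E n → ℝ}
    (hΩ : IsStrictlyConvexDomain 3 Ω) (hp : p ∈ Ω)
    (hmax : IsMaxOn (auxiliaryFunction Ω N b u K) (closure Ω) p) :
    IsLocalMax (fun y => ‖gradient u y - b y • N y‖ ^ 2 + K / 2 * ‖y‖ ^ 2) p := by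
  refine (Filter.EventuallyEq.isLocalMax_iff ?_).1 (hmax.isLocalMax (hΩ.closure_mem_nhds hp))
  filter_upwards [hΩ.isOpen.mem_nhds hp] with y hy
  rw [auxiliaryFunction, tangentialGradient, gradientWithin,
    fderivWithin_of_mem_nhds (hΩ.closure_mem_nhds hy), gradient]

/-- A solution of the approximate problem together with the bounds on its data that enter the
estimates.  The boundary datum is given by an extension `Φ` to `Ω̄`. -/
structure IsBoundedSolution (Ω : Set (E n)) (α : Fin k → E n → ℝ) (Φ : E n → ℝ)
    (ε a A B : ℝ) (u : E n → ℝ) : Prop extends IsApproxSolution k Ω α Φ ε u where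
  eps_nonneg : 0 ≤ ε
  coeffBoundsAt : ∀ x ∈ Ω, CoeffBoundsAt α a A x
  contDiffOn_datum : ContDiffOn ℝ 2 Φ (closure Ω)
  abs_datum_le : ∀ x ∈ Ω, |Φ x| ≤ B
  norm_fderiv_datum_le : ∀ x ∈ Ω, ‖fderiv ℝ Φ x‖ ≤ B
  norm_snd_fderiv_datum_le : ∀ x ∈ Ω, ‖fderiv ℝ (fderiv ℝ Φ) x‖ ≤ B

namespace IsBoundedSolution

theorem abs_datum_sub_le (h : IsBoundedSolution Ω α Φ ε a A B u)
    (hΩ : IsStrictlyConvexDomain 3 Ω) (hN : IsNormalField Ω N R κ c) (ha : 0 ≤ a) (hA : 0 ≤ A)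
    (hε1 : ε ≤ 1) (hx : x ∈ closure Ω) : |Φ x - ε * u x| ≤ B + supConst k A B R := by
  have hΦ : ∀ y ∈ closure Ω, |Φ y| ≤ B := fun y hy =>
    le_on_closure h.abs_datum_le h.contDiffOn_datum.continuousOn.abs continuousOn_const hy
  have hΦ' : ∀ y ∈ frontier Ω, |Φ y| ≤ B := fun y hy => hΦ y hy.1
  have hupper := h.eps_mul_le hΩ hN h.eps_nonneg hΦ' hx
  have hlower := h.neg_le_eps_mul hΩ hN h.eps_nonneg hε1 hΦ'
    (fun y hy l => ha.trans ((h.coeffBoundsAt y hy).le_apply l))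
    (fun y hy => (h.coeffBoundsAt y hy).apply_le) hA hx
  have hR : 0 ≤ R := (norm_nonneg x).trans (hN.norm_le x hx)
  have hB : B ≤ supConst k A B R := le_add_of_nonneg_right (by positivity)
  exact (abs_sub _ _).trans (add_le_add (hΦ x hx) (abs_le.2 ⟨hlower, hupper.trans hB⟩))

theorem le_of_isMaxOn_of_mem (h : IsBoundedSolution Ω α Φ ε a A B u)
    (hΩ : IsStrictlyConvexDomain 3 Ω) (hN : IsNormalField Ω N R κ c) (ha : 0 < a)
    (hε1 : ε ≤ 1) (hb₀ : ∀ x ∈ closure Ω, |Φ x - ε * u x| ≤ b₀)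
    (hM : ∀ x ∈ Ω, ‖fderiv ℝ u x‖ ≤ M) (hp : p ∈ Ω)
    (hmax : IsMaxOn (auxiliaryFunction Ω N (fun y => Φ y - ε * u y) u K) (closure Ω) p) :
    K ≤ 2 * (M + b₀ * c) * (linConst k a A
      + (3 * B + linConst k a A + b₀ + 2 * (ε * M)) * c) := by
  have hpc := subset_closure hp
  have hu : ContDiffAt ℝ 3 u p := h.contDiffOn.contDiffAt (hΩ.isOpen.mem_nhds hp)
  have hu2 : ContDiffAt ℝ 2 u p := hu.of_le (by norm_num)
  have hΦ : ContDiffAt ℝ 2 Φ p := h.contDiffOn_datum.contDiffAt (hΩ.closure_mem_nhds hp)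
  obtain ⟨e, w, hframe⟩ := exists_isLinearizedFrame hΩ.isOpen ha hp h.contDiffOn h.admissible
    h.equation (h.coeffBoundsAt p hp)
  have hgrad : ‖gradient u p‖ ≤ M := by
    rw [gradient, LinearIsometryEquiv.norm_map]
    exact hM p hp
  have hW : ‖gradient u p - (Φ p - ε * u p) • N p‖ ≤ M + b₀ * c :=
    (norm_sub_le _ _).trans (add_le_add hgrad (hN.norm_smul_apply_le hpc (hb₀ p hpc)))
  have hle := hframe.le_of_isLocalMax hu (hΦ.sub (contDiffAt_const.mul hu2))
    hN.contDiff.contDiffAt (hΩ.isLocalMax_of_isMaxOn_auxiliaryFunction hp hmax) rfl (hb₀ p hpc)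
    (norm_fderiv_sub_smul_le (hu2.differentiableAt two_ne_zero) (hΦ.differentiableAt two_ne_zero)
      h.eps_nonneg (h.norm_fderiv_datum_le p hp) (hM p hp))
    (hframe.abs_sum_snd_fderiv_sub_smul_le hu2 hΦ h.eps_nonneg (h.norm_snd_fderiv_datum_le p hp))
    (hN.norm_apply_le p hpc) (hN.norm_fderiv_le p hpc) (hN.norm_snd_fderiv_le p hpc)
  have hε := h.eps_nonneg
  have hC : 0 ≤ linConst k a A := (abs_nonneg _).trans hframe.abs_snd_le
  have hB : 0 ≤ B := (norm_nonneg _).trans (h.norm_fderiv_datum_le p hp)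
  have hM0 : 0 ≤ M := (norm_nonneg _).trans (hM p hp)
  have hb₀0 : 0 ≤ b₀ := (abs_nonneg _).trans (hb₀ p hpc)
  have hc : 0 ≤ c := (norm_nonneg _).trans (hN.norm_apply_le p hpc)
  have hεC : ε * linConst k a A ≤ linConst k a A := mul_le_of_le_one_left hC hε1
  refine hle.trans ?_
  gcongr 2 * ?_ * (_ + ?_ * _)
  linarith

theorem norm_sq_tangentialGradient_le (h : IsBoundedSolution Ω α Φ ε a A B u)
    (hΩ : IsStrictlyConvexDomain 3 Ω) (hN : IsNormalField Ω N R κ c)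
    (hb₀ : ∀ x ∈ closure Ω, |Φ x - ε * u x| ≤ b₀) (hK : 0 ≤ K) (hp : p ∈ frontier Ω)
    (hmax : IsMaxOn (auxiliaryFunction Ω N (fun y => Φ y - ε * u y) u K) (closure Ω) p) :
    ‖tangentialGradient Ω N (fun y => Φ y - ε * u y) u p‖ ^ 2
      ≤ (B + 2 * b₀ * c) ^ 2 / κ ^ 2 + K * R / κ := by
  have hpc : p ∈ closure Ω := hp.1
  have hbc : ∀ q ∈ frontier Ω, fderivWithin ℝ u (closure Ω) q (N q) = Φ q - ε * u q :=
    fun q hq => by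
      rw [h.neumann q hq _ (hN.isOuterUnitNormal q hq)]
      ring
  have hΦ := (h.contDiffOn_datum.differentiableOn two_ne_zero p hpc).hasFDerivWithinAt
  have hΦB : ‖fderivWithin ℝ Φ (closure Ω) p‖ ≤ B :=
    le_on_closure (f := fun y => ‖fderivWithin ℝ Φ (closure Ω) y‖) (g := fun _ => B)
      (fun y hy => by
        rw [fderivWithin_of_mem_nhds (hΩ.closure_mem_nhds hy)]
        exact h.norm_fderiv_datum_le y hy)
      (h.contDiffOn_datum.continuousOn_fderivWithin hΩ.uniqueDiffOn one_le_two).norm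
      continuousOn_const hpc
  refine hΩ.norm_sq_tangentialGradient_le_of_isMaxOn hN h.contDiffOn_closure hbc hp
    (hΦ.fun_sub ((h.hasFDerivWithinAt hpc).const_mul ε)) hK hmax rfl (hb₀ p hpc) ?_
  set τ := tangentialGradient Ω N (fun y => Φ y - ε * u y) u p with hτ
  have hort : ⟪N p, τ⟫ = 0 :=
    inner_normal_tangentialGradient (hN.isOuterUnitNormal p hp) (hbc p hp)
  have hDτ : fderivWithin ℝ u (closure Ω) p τ = ‖τ‖ ^ 2 := by
    rw [fderivWithin_apply_eq_inner_tangentialGradient_add (N := N)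
      (b := fun y => Φ y - ε * u y), ← hτ, hort, mul_zero, add_zero, real_inner_self_eq_norm_sq]
  calc (fderivWithin ℝ Φ (closure Ω) p - ε • fderivWithin ℝ u (closure Ω) p) τ
      = fderivWithin ℝ Φ (closure Ω) p τ - ε * ‖τ‖ ^ 2 := by simp [hDτ]
    _ ≤ fderivWithin ℝ Φ (closure Ω) p τ :=
      sub_le_self _ (mul_nonneg h.eps_nonneg (sq_nonneg _))
    _ ≤ B * ‖τ‖ := (le_abs_self _).trans (ContinuousLinearMap.le_of_opNorm_le _ hΦB τ)

theorem norm_sq_fderiv_le (h : IsBoundedSolution Ω α Φ ε a A B u)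
    (hΩ : IsStrictlyConvexDomain 3 Ω) (hN : IsNormalField Ω N R κ c) (ha : 0 < a)
    (hε1 : ε ≤ 1) (hb₀ : ∀ x ∈ closure Ω, |Φ x - ε * u x| ≤ b₀)
    (hM : ∀ x ∈ Ω, ‖fderiv ℝ u x‖ ≤ M) (hK0 : 0 ≤ K)
    (hK : 2 * (M + b₀ * c) * (linConst k a A
      + (3 * B + linConst k a A + b₀ + 2 * (ε * M)) * c) < K) (hx : x ∈ Ω) :
    ‖fderiv ℝ u x‖ ^ 2 ≤
      2 * ((B + 2 * b₀ * c) ^ 2 / κ ^ 2 + K * R / κ + K / 2 * R ^ 2) + 2 * (b₀ * c) ^ 2 := by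
  set b : E n → ℝ := fun y => Φ y - ε * u y
  have hxc := subset_closure hx
  have hcont : ContinuousOn (auxiliaryFunction Ω N b u K) (closure Ω) := by
    have hgrad : ContinuousOn (gradientWithin u (closure Ω)) (closure Ω) :=
      (InnerProductSpace.toDual ℝ (E n)).symm.continuous.comp_continuousOn
        (h.contDiffOn_closure.continuousOn_fderivWithin hΩ.uniqueDiffOn one_le_two)
    have hb : ContinuousOn b (closure Ω) := h.contDiffOn_datum.continuousOn.sub
      (continuousOn_const.mul h.contDiffOn_closure.continuousOn)
    exact ((hgrad.sub (hb.smul hN.contDiff.continuous.continuousOn)).norm.pow 2).add (by fun_prop)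
  obtain ⟨p, hp, hmax⟩ := hΩ.isCompact_closure.exists_isMaxOn ⟨x, hxc⟩ hcont
  have hpf : p ∈ frontier Ω := (hΩ.mem_or_mem_frontier hp).resolve_left fun hpΩ =>
    (h.le_of_isMaxOn_of_mem hΩ hN ha hε1 hb₀ hM hpΩ hmax).not_gt hK
  have hpτ := h.norm_sq_tangentialGradient_le hΩ hN hb₀ hK0 hpf hmax
  have hxτ : ‖tangentialGradient Ω N b u x‖ ^ 2
      ≤ (B + 2 * b₀ * c) ^ 2 / κ ^ 2 + K * R / κ + K / 2 * R ^ 2 := by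
    have hle : _ + K / 2 * ‖x‖ ^ 2 ≤ _ + K / 2 * ‖p‖ ^ 2 := hmax hxc
    have hpR : K / 2 * ‖p‖ ^ 2 ≤ K / 2 * R ^ 2 := by gcongr; exact hN.norm_le p hp
    have hx0 : 0 ≤ K / 2 * ‖x‖ ^ 2 := by positivity
    linarith
  have hbN : ‖b x • N x‖ ≤ b₀ * c := hN.norm_smul_apply_le hxc (hb₀ x hxc)
  calc ‖fderiv ℝ u x‖ ^ 2 = ‖tangentialGradient Ω N b u x + b x • N x‖ ^ 2 := by
        rw [tangentialGradient, sub_add_cancel, gradientWithin, LinearIsometryEquiv.norm_map,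
          fderivWithin_of_mem_nhds (hΩ.closure_mem_nhds hx)]
    _ ≤ (‖tangentialGradient Ω N b u x‖ + ‖b x • N x‖) ^ 2 := by gcongr; exact norm_add_le _ _
    _ ≤ 2 * (‖tangentialGradient Ω N b u x‖ ^ 2 + ‖b x • N x‖ ^ 2) := add_sq_le
    _ ≤ _ := by rw [mul_add]; gcongr

end IsBoundedSolution

theorem IsStrictlyConvexDomain.bddAbove_norm_fderiv (hΩ : IsStrictlyConvexDomain 3 Ω)
    (hu : ContDiffOn ℝ 2 u (closure Ω)) : BddAbove ((fun x => ‖fderiv ℝ u x‖) '' Ω) := by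
  obtain ⟨M, hM⟩ := hΩ.isCompact_closure.exists_bound_of_continuousOn
    (hu.continuousOn_fderivWithin hΩ.uniqueDiffOn one_le_two)
  refine ⟨M, Set.forall_mem_image.2 fun x hx => ?_⟩
  rw [← fderivWithin_of_mem_nhds (hΩ.closure_mem_nhds hx)]
  exact hM x (subset_closure hx)

theorem exists_forall_le_of_sq_le {P₀ P₁ s c L : ℝ} (hP₀ : 0 ≤ P₀) (hP₁ : 0 ≤ P₁) (hs : 0 ≤ s)
    (hc : 0 ≤ c) (hL : 0 ≤ L) : ∃ ε₀ M₁ : ℝ, 0 < ε₀ ∧ ε₀ ≤ 1 ∧ ∀ ε M : ℝ, 0 ≤ ε → ε < ε₀ →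
      0 ≤ M → M ^ 2 ≤ P₀ + P₁ * (2 * (M + s) * (L + 2 * (ε * M) * c) + 1) → M ≤ M₁ := by
  set Q₀ : ℝ := P₀ + P₁ * (2 * s * L + 1)
  set Q₁ : ℝ := P₁ * (2 * L + 4 * s * c)
  have hQ₀ : 0 ≤ Q₀ := by positivity
  have hQ₁ : 0 ≤ Q₁ := by positivity
  refine ⟨1 / (8 * c * P₁ + 1), 2 * Q₁ + 2 * Q₀ + 1, by positivity,
    div_le_one_of_le₀ (le_add_of_nonneg_left (by positivity)) (by positivity),
    fun ε M hε hε₀ hM h => ?_⟩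
  rw [lt_div_iff₀ (by positivity)] at hε₀
  have hεcP : 0 ≤ ε * (8 * c * P₁) := by positivity
  have hquad : M ^ 2 * (ε * (8 * c * P₁)) ≤ M ^ 2 * 1 := by
    gcongr
    linarith
  have hlin : ε * (P₁ * s * c * M) ≤ P₁ * s * c * M :=
    mul_le_of_le_one_left (by positivity) (by linarith)
  have habsorbed : M ^ 2 ≤ M ^ 2 / 2 + Q₁ * M + Q₀ := by
    simp only [Q₀, Q₁]
    linarith
  by_contra! hlt
  have hM1 : 1 < M := by linarith
  nlinarith

theorem IsStrictlyConvexDomain.exists_norm_fderiv_le (hΩ : IsStrictlyConvexDomain 3 Ω) (k : ℕ)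
    (ha : 0 < a) (hA : 0 ≤ A) (hB : 0 ≤ B) : ∃ ε₀ M₁ : ℝ, 0 < ε₀ ∧
      ∀ {α : Fin k → E n → ℝ} {Φ : E n → ℝ} {ε : ℝ} {u : E n → ℝ},
        IsBoundedSolution Ω α Φ ε a A B u → ε < ε₀ → ∀ x ∈ Ω, ‖fderiv ℝ u x‖ ≤ M₁ := by
  obtain ⟨N, R, κ, c, hN⟩ := hΩ.exists_isNormalField
  obtain ⟨x₀, hx₀⟩ := hΩ.nonempty
  have hR : 0 ≤ R := (norm_nonneg x₀).trans (hN.norm_le x₀ (subset_closure hx₀))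
  have hc : 0 ≤ c := (norm_nonneg _).trans (hN.norm_apply_le x₀ (subset_closure hx₀))
  have hκ := hN.curvature_pos
  set b₀ := B + supConst k A B R with hb₀def
  have hb₀ : 0 ≤ b₀ := by rw [hb₀def, supConst]; positivity
  set C := linConst k a A with hCdef
  have hC : 0 ≤ C := by rw [hCdef, linConst]; positivity
  obtain ⟨ε₀, M₁, hε₀, hε₀1, hM₁⟩ := exists_forall_le_of_sq_le
    (P₀ := 2 * ((B + 2 * b₀ * c) ^ 2 / κ ^ 2) + 2 * (b₀ * c) ^ 2) (P₁ := 2 * (R / κ) + R ^ 2)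
    (s := b₀ * c) (c := c) (L := C + (3 * B + C + b₀) * c)
    (by positivity) (by positivity) (by positivity) hc (by positivity)
  refine ⟨ε₀, M₁, hε₀, fun {α Φ ε u} h hε x hx => ?_⟩
  have hε1 : ε ≤ 1 := hε.le.trans hε₀1
  obtain ⟨M, hM⟩ := Real.exists_isLUB (hΩ.nonempty.image _)
    (hΩ.bddAbove_norm_fderiv h.contDiffOn_closure)
  have hle : ∀ x ∈ Ω, ‖fderiv ℝ u x‖ ≤ M := fun x hx => hM.1 (Set.mem_image_of_mem _ hx)
  have hM0 : 0 ≤ M := (norm_nonneg _).trans (hle x hx)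
  have hεM : 0 ≤ ε * M := mul_nonneg h.eps_nonneg hM0
  set K := 2 * (M + b₀ * c) * (C + (3 * B + C + b₀ + 2 * (ε * M)) * c) + 1 with hK
  set Q := 2 * ((B + 2 * b₀ * c) ^ 2 / κ ^ 2 + K * R / κ + K / 2 * R ^ 2) + 2 * (b₀ * c) ^ 2
    with hQ
  have hsq : ∀ y ∈ Ω, ‖fderiv ℝ u y‖ ^ 2 ≤ Q := fun y hy =>
    h.norm_sq_fderiv_le hΩ hN ha hε1 (fun z hz => h.abs_datum_sub_le hΩ hN ha.le hA hε1 hz) hle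
      (by positivity) (lt_add_one _) hy
  have hMQ : M ≤ √Q := hM.2 (Set.forall_mem_image.2 fun y hy => Real.le_sqrt_of_sq_le (hsq y hy))
  refine (hle x hx).trans (hM₁ ε M h.eps_nonneg hε hM0 ?_)
  calc M ^ 2 ≤ Q := (Real.le_sqrt hM0 ((sq_nonneg _).trans (hsq x hx))).1 hMQ
    _ = _ := by rw [hQ, hK]; ring

end GradientBound

/-! ### The estimates in terms of the norms of the data -/

section Norms

variable {n m : ℕ} {Ω : Set (E n)} {f : E n → ℝ} {B : ℝ≥0} {x : E n}

theorem norm_iteratedFDeriv_le_of_cNorm {j : ℕ} (h : cNorm m Ω f ≤ B) (hj : j ≤ m) (hx : x ∈ Ω) :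
    ‖iteratedFDeriv ℝ j f x‖ ≤ B := by
  have hsup : ‖iteratedFDeriv ℝ j f x‖ₑ ≤ cNorm m Ω f :=
    (le_iSup₂ (f := fun x (_ : x ∈ Ω) => ‖iteratedFDeriv ℝ j f x‖ₑ) x hx).trans
      (Finset.single_le_sum (f := fun j => ⨆ x ∈ Ω, ‖iteratedFDeriv ℝ j f x‖ₑ)
        (fun _ _ => zero_le) (Finset.mem_range.2 (Nat.lt_succ_of_le hj)))
  exact_mod_cast enorm_le_coe.1 (hsup.trans h)

theorem abs_le_of_cNorm (h : cNorm m Ω f ≤ B) (hx : x ∈ Ω) : |f x| ≤ B := by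
  simpa using norm_iteratedFDeriv_le_of_cNorm h m.zero_le hx

theorem norm_fderiv_le_of_cNorm (h : cNorm m Ω f ≤ B) (hm : 1 ≤ m) (hx : x ∈ Ω) :
    ‖fderiv ℝ f x‖ ≤ B :=
  norm_iteratedFDeriv_one (𝕜 := ℝ) f ▸ norm_iteratedFDeriv_le_of_cNorm h hm hx

theorem norm_snd_fderiv_le_of_cNorm (h : cNorm m Ω f ≤ B) (hm : 2 ≤ m) (hx : x ∈ Ω) :
    ‖fderiv ℝ (fderiv ℝ f) x‖ ≤ B := by
  rw [← norm_iteratedFDeriv_one, norm_iteratedFDeriv_fderiv]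
  exact norm_iteratedFDeriv_le_of_cNorm h hm hx

theorem exists_isExtension_cNorm_le (h : cBoundaryNorm m Ω f ≤ B) :
    ∃ Φ, IsExtension m Ω f Φ ∧ cNorm m Ω Φ ≤ (B + 1 : ℝ≥0) := by
  have hlt : cBoundaryNorm m Ω f < (B + 1 : ℝ≥0) :=
    h.trans_lt (ENNReal.coe_lt_coe.2 (lt_add_one B))
  obtain ⟨Φ, hΦ⟩ := iInf_lt_iff.1 hlt
  obtain ⟨hext, hΦ⟩ := iInf_lt_iff.1 hΦ
  exact ⟨Φ, hext, hΦ.le⟩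

theorem IsApproxSolution.isBoundedSolution {k : ℕ} {α : Fin k → E n → ℝ} {φ Φ u : E n → ℝ}
    {ε a : ℝ} {A : ℝ≥0} (h : IsApproxSolution k Ω α φ ε u) (hΩ : IsOpen Ω) (hε : 0 ≤ ε)
    (hα : ∀ l, DifferentiableOn ℝ (α l) Ω) (hαa : ∀ l, ∀ x ∈ Ω, a ≤ α l x)
    (hαA : ∀ l, cNorm 1 Ω (α l) ≤ A) (hΦ : IsExtension 2 Ω φ Φ) (hΦB : cNorm 2 Ω Φ ≤ B) :
    IsBoundedSolution Ω α Φ ε a A B u where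
  toIsApproxSolution := { h with neumann := fun p hp ν hν => by rw [hΦ.2 hp, h.neumann p hp ν hν] }
  eps_nonneg := hε
  coeffBoundsAt x hx :=
    { differentiableAt := fun l => (hα l).differentiableAt (hΩ.mem_nhds hx)
      le_apply := fun l => hαa l x hx
      apply_le := fun l => le_of_abs_le (abs_le_of_cNorm (hαA l) hx)
      norm_fderiv_le := fun l => norm_fderiv_le_of_cNorm (hαA l) le_rfl hx }
  contDiffOn_datum := hΦ.1
  abs_datum_le _ := abs_le_of_cNorm hΦB
  norm_fderiv_datum_le _ := norm_fderiv_le_of_cNorm hΦB one_le_two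
  norm_snd_fderiv_datum_le _ := norm_snd_fderiv_le_of_cNorm hΦB le_rfl

end Norms

theorem norm_sub_setAverage_le {V F : Type*} [NormedAddCommGroup V] [NormedSpace ℝ V]
    [MeasurableSpace V] [NormedAddCommGroup F] [NormedSpace ℝ F] [CompleteSpace F]
    {μ : Measure V} {s : Set V} {f : V → F} {M : ℝ} {x : V} (hs : Convex ℝ s)
    (hsb : Bornology.IsBounded s) (hsm : MeasurableSet s) (hμ₀ : μ s ≠ 0) (hμ : μ s ≠ ∞)
    (hf : ∀ y ∈ s, DifferentiableAt ℝ f y) (hfi : IntegrableOn f s μ)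
    (hM : ∀ y ∈ s, ‖fderiv ℝ f y‖ ≤ M) (hx : x ∈ s) :
    ‖f x - ⨍ y in s, f y ∂μ‖ ≤ M * Metric.diam s := by
  have hM0 : 0 ≤ M := (norm_nonneg _).trans (hM x hx)
  have hosc : ∀ y ∈ s, f y ∈ Metric.closedBall (f x) (M * Metric.diam s) := fun y hy => by
    rw [mem_closedBall_iff_norm]
    refine (hs.norm_image_sub_le_of_norm_fderiv_le hf hM hx hy).trans ?_
    gcongr
    exact dist_eq_norm y x ▸ Metric.dist_le_diam_of_mem hsb hy hx
  have hmem := (convex_closedBall (f x) (M * Metric.diam s)).set_average_mem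
    Metric.isClosed_closedBall hμ₀ hμ (ae_restrict_of_forall_mem hsm hosc) hfi
  rwa [mem_closedBall_iff_norm'] at hmem

end MixedHessian

end

theorem theorem3p2_general (n k : ℕ) (Ω : Set (MixedHessian.E n))
    (hΩ : MixedHessian.IsStrictlyConvexDomain 3 Ω) (a : ℝ) (ha : 0 < a) (A B : ℝ≥0) :
    ∃ ε₀ M₁ M₀ : ℝ, 0 < ε₀ ∧
      ∀ (α : Fin k → MixedHessian.E n → ℝ) (φ : MixedHessian.E n → ℝ),
        (∀ l, DifferentiableOn ℝ (α l) Ω) →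
        (∀ l, ∀ x ∈ Ω, a ≤ α l x) →
        (∀ l, MixedHessian.cNorm 1 Ω (α l) ≤ A) →
        MixedHessian.cBoundaryNorm 2 Ω φ ≤ B →
        ∀ ε : ℝ, 0 ≤ ε → ε < ε₀ →
        ∀ u : MixedHessian.E n → ℝ, MixedHessian.IsApproxSolution k Ω α φ ε u →
          (∀ x ∈ Ω, ‖gradient u x‖ ≤ M₁) ∧
          (∀ x ∈ Ω, |u x - (1 / volume.real Ω) * ∫ y in Ω, u y| ≤ M₀) := by
  obtain ⟨ε₀, M₁, hε₀, hM₁⟩ := hΩ.exists_norm_fderiv_le k ha A.coe_nonneg (B + 1).coe_nonneg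
  refine ⟨ε₀, M₁, M₁ * Metric.diam Ω, hε₀, fun α φ hα hαa hαA hφB ε hε hεε₀ u hu => ?_⟩
  obtain ⟨Φ, hΦ, hΦB⟩ := MixedHessian.exists_isExtension_cNorm_le hφB
  have hgrad : ∀ x ∈ Ω, ‖fderiv ℝ u x‖ ≤ M₁ :=
    hM₁ (hu.isBoundedSolution hΩ.isOpen hε hα hαa hαA hΦ hΦB) hεε₀
  refine ⟨fun x hx => ?_, fun x hx => ?_⟩
  · rw [gradient, LinearIsometryEquiv.norm_map]
    exact hgrad x hx
  have hosc := MixedHessian.norm_sub_setAverage_le hΩ.convex hΩ.isBounded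
    hΩ.isOpen.measurableSet (hΩ.isOpen.measure_pos volume hΩ.nonempty).ne'
    hΩ.isBounded.measure_lt_top.ne
    (fun y hy => (hu.contDiffOn.contDiffAt (hΩ.isOpen.mem_nhds hy)).differentiableAt (by norm_num))
    ((hu.contDiffOn_closure.continuousOn.integrableOn_compact hΩ.isCompact_closure).mono_set
      subset_closure) hgrad hx
  rwa [setAverage_eq, smul_eq_mul, ← one_div, Real.norm_eq_abs] at hosc

theorem theorem3p2 (n k : ℕ) (hk : 2 ≤ k) (hkn : k ≤ n)
    (Ω : Set (MixedHessian.E n)) (hΩ : MixedHessian.IsStrictlyConvexDomain 3 Ω)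
    (a : ℝ) (ha : 0 < a) (A B : ℝ≥0) :
    ∃ ε₀ M₁ M₀ : ℝ, 0 < ε₀ ∧
      ∀ (α : Fin k → MixedHessian.E n → ℝ) (φ : MixedHessian.E n → ℝ),
        (∀ l, ContDiffOn ℝ 1 (α l) (closure Ω)) →
        (∀ l, ∀ x ∈ closure Ω, a ≤ α l x) →
        (∀ l, MixedHessian.cNorm 1 Ω (α l) ≤ A) →
        MixedHessian.MemCBoundary 2 Ω φ →
        MixedHessian.cBoundaryNorm 2 Ω φ ≤ B →
        ∀ (ε : ℝ), 0 < ε → ε < ε₀ →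
        ∀ u : MixedHessian.E n → ℝ, MixedHessian.IsApproxSolution k Ω α φ ε u →
          (∀ x ∈ Ω, ‖gradient u x‖ ≤ M₁) ∧
          (∀ x ∈ Ω, |u x - (1 / volume.real Ω) * ∫ y in Ω, u y| ≤ M₀) := by
  obtain ⟨ε₀, M₁, M₀, hε₀, h⟩ := theorem3p2_general n k Ω hΩ a ha A B
  exact ⟨ε₀, M₁, M₀, hε₀, fun α φ hα hαa hαA _ hφB ε hε => h α φ
    (fun l => ((hα l).differentiableOn one_ne_zero).mono subset_closure)
    (fun l x hx => hαa l x (subset_closure hx)) hαA hφB ε hε.le⟩
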